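/- Consider power series over $\mathbb{C}$ in the variables $x,y,z$. Let $f=1$, $g=x(e^z-1)$, $h=yz-x$, with assigned scopes $(x,y)$, $(x,y)$, $(x,y,z)$, and put $$I=\mathbb{C}\{x,y\}f+\mathbb{C}\{x,y\}g+\mathbb{C}\{x,y,z\}h,\qquad \widehat I=\mathbb{C}[[x,y]]f+\mathbb{C}[[x,y]]g+\mathbb{C}[[x,y,z]]h .$$ Order the monomials $x^iy^jz^k$ lexicographically by $(i,j,k)$, so that $z<y<x$. The initial monomial $\mathrm{in}(p)$ of a series $p\neq 0$ is the smallest monomial occurring in it. For $p,q\ne 0$ with initial exponents $\alpha,\beta$ and initial coefficients $c_p,c_q$, and $\gamma=\max(\alpha,\beta)$ componentwise, let $S(p,q)=-c_q\,(x,y,z)^{\gamma-\alpha}p+c_p\,(x,y,z)^{\gamma-\beta}q$. Given nonzero series $F_i$ with scopes $s_i$ (the first $s_i$ variables) and initial exponents $\alpha_i$, put $A=\bigcup_i(\alpha_i+\mathbb{N}^{s_i}\times 0)$ and fix a partition $A=\bigsqcup_i A_i$ with $A_i\subseteq \alpha_i+\mathbb{N}^{s_i}\times 0$. A division of $p$ by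 the $F_i$ is a decomposition $p=\sum_i a_iF_i+b$, where $a_i$ is a formal series in the first $s_i$ variables, the exponents of $a_i\cdot \mathrm{in}(F_i)$ lie in $A_i$, no exponent of $b$ lies in $A$, and $\mathrm{in}(p-b)=\min_i \mathrm{in}(a_i)\,\mathrm{in}(F_i)$; $b$ is its remainder. For $1\le k\le i$ let $$q_{i,k}=\frac{(i-1)!}{4^{k-1}\,(i-k)!\,(i+k-1)!\,\left(\tfrac12\right)^{\overline{k-1}}},\qquad g_k=x^k\sum_{i\ge k}q_{i,k}z^i,$$ where $\left(\tfrac12\right)^{\overline{k-1}}=\tfrac12\left(\tfrac12+1\right)\cdots\left(\tfrac12+k-2\right)$ is the rising factorial. Then: 1. The sums defining $I$ and $\widehat I$ are direct, and if $af+bg+ch=0$ with $a,b\in\mathbb{C}[[x,y]]$, $c\in\mathbb{C}[[x,y,z]]$, then $a=b=c=0$. 2. $g_1=g$ and, for every $k\ge 1$ and every choice of the partition, $g_{k+1}$ is the unique remainder of the division of $S(g_k,h)$ by $f,h,g_1,\dots,g_k$, where the $g_j$ have scope $(x,y)$. The series $f,h,g_1,g_2,\dots$, with scope $(x,y,z)$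 for $h$ and $(x,y)$ for all others, form an echelon standard basis of $I$ and of $\widehat I$: they and their multiples by convergent, respectively formal, series in the variables of their scopes belong to $I$, respectively $\widehat I$, and the set of exponents of initial monomials of nonzero elements of $I$, respectively $\widehat I$, is the union of the sets $\alpha+\mathbb{N}^s\times 0^{3-s}$, where $\alpha$ is the initial exponent and $s$ the number of scope variables of an element of the basis. 3. For $k\ge1$ the initial term of $g_k$ is $q_{k,k}x^kz^k$. One has $q_{k,k}>0$ and $$\frac{q_{k+1,k+1}}{q_{k,k}}=\frac{1}{4(2k+1)(2k-1)},\qquad 0<\frac{q_{i,k}}{q_{k,k}}\le 1\quad(i\ge k),$$ and $\rho^kq_{k,k}\to 0$ as $k\to\infty$ for every real $\rho$. 4. For every $m\ge 1$ (for instance $m=1$ or $m=2$) the formal sum $e=\sum_{k\ge m} g_k/q_{k,k}$ is a convergent power series in $x,z$ that lies in $\widehat I\cap\mathbb{C}\{x,y,z\}$ but not in $I$. There are unique formal series $a,b\in\mathbb{C}[[x,y]]$ and $c\in\mathbb{C}[[x,y,z]]$ with $e=af+bg+ch$, and each of $a$, $b$, $c$ is divergent. -/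

import Mathlib

open MvPowerSeries

namespace Echelon

noncomputable section

/-- Formal power series in `n` variables over `ℂ`. -/
abbrev Ser (n : ℕ) := MvPowerSeries (Fin n) ℂ

/-- A power series is convergent if it converges absolutely on some polydisc around `0`. -/
def IsConvergent {n : ℕ} (F : Ser n) : Prop :=
  ∃ r : ℝ, 0 < r ∧ Summable (fun d : Fin n →₀ ℕ => ‖coeff d F‖ * r ^ d.degree)

theorem IsConvergent.add {n : ℕ} {F G : Ser n} (hF : IsConvergent F) (hG : IsConvergent G) :
    IsConvergent (F + G) := by
  obtain ⟨r, hr, hF⟩ := hF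
  obtain ⟨t, ht, hG⟩ := hG
  refine ⟨min r t, lt_min hr ht, Summable.of_nonneg_of_le (fun d => by positivity)
    (fun d => ?_) (hF.add hG)⟩
  have h0 : 0 ≤ min r t := (lt_min hr ht).le
  have h1 : min r t ^ d.degree ≤ r ^ d.degree := pow_le_pow_left₀ h0 (min_le_left _ _) _
  have h2 : min r t ^ d.degree ≤ t ^ d.degree := pow_le_pow_left₀ h0 (min_le_right _ _) _
  calc ‖coeff d (F + G)‖ * min r t ^ d.degree
      ≤ (‖coeff d F‖ + ‖coeff d G‖) * min r t ^ d.degree := by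
        rw [map_add]
        exact mul_le_mul_of_nonneg_right (norm_add_le _ _) (pow_nonneg h0 _)
    _ = ‖coeff d F‖ * min r t ^ d.degree + ‖coeff d G‖ * min r t ^ d.degree := by ring
    _ ≤ _ := add_le_add (mul_le_mul_of_nonneg_left h1 (norm_nonneg _))
        (mul_le_mul_of_nonneg_left h2 (norm_nonneg _))

theorem IsConvergent.smul {n : ℕ} {F : Ser n} (c : ℂ) (hF : IsConvergent F) :
    IsConvergent (c • F) := by
  obtain ⟨r, hr, hF⟩ := hF
  refine ⟨r, hr, (hF.mul_left ‖c‖).congr fun d => ?_⟩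
  rw [map_smul, norm_smul, mul_assoc]

theorem isConvergent_zero {n : ℕ} : IsConvergent (0 : Ser n) :=
  ⟨1, one_pos, by simp⟩

/-- The space `ℂ{x₁,…,xₙ}` of convergent power series. -/
def convergentSeries (n : ℕ) : Submodule ℂ (Ser n) where
  carrier := {F | IsConvergent F}
  add_mem' := IsConvergent.add
  zero_mem' := isConvergent_zero
  smul_mem' c _ hF := hF.smul c

/-- The set `ℕˢ × 0ⁿ⁻ˢ` of exponents of monomials in the first `s` of `n` variables. -/
def scopeExponents (n s : ℕ) : Set (Fin n →₀ ℕ) := {d | ∀ i : Fin n, s ≤ i.val → d i = 0}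

/-- The space `ℂ[[x₁,…,xₛ]]`, as a subspace of `ℂ[[x₁,…,xₙ]]`. -/
def formalScope (n s : ℕ) : Submodule ℂ (Ser n) where
  carrier := {F | ∀ d, coeff d F ≠ 0 → d ∈ scopeExponents n s}
  add_mem' := by
    intro F G hF hG d hd
    by_cases h : coeff d F = 0
    · exact hG d fun h' => hd (by rw [map_add, h, h', add_zero])
    · exact hF d h
  zero_mem' := by intro d hd; simp at hd
  smul_mem' := by
    intro c F hF d hd
    exact hF d fun h => hd (by rw [map_smul, h, smul_zero])

/-- The space `ℂ{x₁,…,xₛ}`, as a subspace of `ℂ{x₁,…,xₙ}`. -/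
def convScope (n s : ℕ) : Submodule ℂ (Ser n) := formalScope n s ⊓ convergentSeries n

/-- The subspace `R · F` of multiples of the series `F` by elements of the subspace `R`. -/
def summand {n : ℕ} (R : Submodule ℂ (Ser n)) (F : Ser n) : Submodule ℂ (Ser n) :=
  R.map (LinearMap.mulRight ℂ F)

/-- The echelon `∑ᵢ R(sᵢ) · Fᵢ` with generators `Fᵢ` and assigned scopes `sᵢ`;
`R` is `formalScope n` or `convScope n`. -/
def echelon {n : ℕ} {ι : Type} (R : ℕ → Submodule ℂ (Ser n)) (F : ι → Ser n) (s : ι → ℕ) :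
    Submodule ℂ (Ser n) := ⨆ i, summand (R (s i)) (F i)

/-- The exponent of the initial (lexicographically smallest) monomial of a nonzero series.
The first variable is the largest one in the lexicographic order. -/
def initExp {n : ℕ} (F : Ser n) : Fin n →₀ ℕ := ofLex (F.lexOrder.untopD 0)

/-- The exponents of the initial monomials of the nonzero elements of a subspace. -/
def initialExponents {n : ℕ} (I : Submodule ℂ (Ser n)) : Set (Fin n →₀ ℕ) :=
  {d | ∃ F ∈ I, F ≠ 0 ∧ initExp F = d}

/-- The set `α + (ℕˢ × 0ⁿ⁻ˢ)`, where `α` is the initial exponent of `F`. -/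
def region {n : ℕ} (F : Ser n) (s : ℕ) : Set (Fin n →₀ ℕ) :=
  {d | ∃ v ∈ scopeExponents n s, d = initExp F + v}

/-- The (nonzero) series `G j`, with assigned scopes `t j`, form an echelon standard basis of
`I`: they and their multiples respecting the scopes lie in `I`, and their initial monomials
generate, respecting the scopes, the initial monomials of `I`. -/
def IsStandardBasis {n : ℕ} {ι : Type} (R : ℕ → Submodule ℂ (Ser n)) (I : Submodule ℂ (Ser n))
    (G : ι → Ser n) (t : ι → ℕ) : Prop :=
  (∀ j, G j ≠ 0) ∧ (∀ j, G j ∈ I) ∧ (∀ j, summand (R (t j)) (G j) ≤ I) ∧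
    initialExponents I = ⋃ j, region (G j) (t j)

/-- The combination `S(p, q)` of `p` and `q` by the minimal monomial relation between their
initial terms. -/
def sSeries {n : ℕ} (p q : Ser n) : Ser n :=
  -(monomial ((initExp p ⊔ initExp q) - initExp p) (coeff (initExp q) q) * p) +
    monomial ((initExp p ⊔ initExp q) - initExp q) (coeff (initExp p) p) * q

/-- `P` is a partition `A = ⋃ Pᵢ` of the set `A = ⋃ᵢ (αᵢ + (ℕ^{sᵢ} × 0))` of exponents, where
`αᵢ` is the initial exponent of `Fᵢ`, with `Pᵢ ⊆ αᵢ + (ℕ^{sᵢ} × 0)`. -/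
def IsPartition {n : ℕ} {ι : Type} (F : ι → Ser n) (s : ι → ℕ) (P : ι → Set (Fin n →₀ ℕ)) :
    Prop :=
  (∀ i, P i ⊆ region (F i) (s i)) ∧ Pairwise (fun i j => Disjoint (P i) (P j)) ∧
    ⋃ i, P i = ⋃ i, region (F i) (s i)

/-- `b` is the remainder of an echelon power series division `p = ∑ aᵢ Fᵢ + b` of `p` by the
series `Fᵢ` with assigned scopes `sᵢ`, where the quotients satisfy the support conditions
given by the partition `P`. -/
def IsRemainder {n : ℕ} {ι : Type} [Fintype ι] (F : ι → Ser n) (s : ι → ℕ)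
    (P : ι → Set (Fin n →₀ ℕ)) (p b : Ser n) : Prop :=
  ∃ a : ι → Ser n,
    (∀ i, a i ∈ formalScope n (s i)) ∧
    p = ∑ i, a i * F i + b ∧
    (∀ d, coeff d b ≠ 0 → d ∉ ⋃ i, region (F i) (s i)) ∧
    (∀ i d, coeff d (a i) ≠ 0 → d + initExp (F i) ∈ P i) ∧
    (p - b).lexOrder = Finset.univ.inf (fun i => (a i).lexOrder + (F i).lexOrder)

/-- `e = ∑ₖ uₖ`, coefficientwise, each coefficient being a finite sum. -/
def IsFormalSum {n : ℕ} (u : ℕ → Ser n) (e : Ser n) : Prop :=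
  ∀ d, (Function.support fun k => coeff d (u k)).Finite ∧ coeff d e = ∑ᶠ k, coeff d (u k)

end

end Echelon

namespace Gabrielov

open Echelon

noncomputable section

/- The variables `x`, `y`, `z` are `X 0`, `X 1`, `X 2`. -/

/-- `f = 1` -/
def f : Ser 3 := 1

/-- `g = x (eᶻ - 1)` -/
def g : Ser 3 := X 0 * ((PowerSeries.exp ℂ).subst (X 2 : Ser 3) - 1)

/-- `h = y z - x` -/
def h : Ser 3 := X 1 * X 2 - X 0

/-- The generators `f, g, h`. -/
def gens : Fin 3 → Ser 3 := ![f, g, h]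

/-- The scopes `(x,y)`, `(x,y)`, `(x,y,z)` of `f, g, h`. -/
def scopes : Fin 3 → ℕ := ![2, 2, 3]

/-- `I = ℂ{x,y} f + ℂ{x,y} g + ℂ{x,y,z} h` -/
def I : Submodule ℂ (Ser 3) := echelon (convScope 3) gens scopes

/-- `Î = ℂ[[x,y]] f + ℂ[[x,y]] g + ℂ[[x,y,z]] h` -/
def Ihat : Submodule ℂ (Ser 3) := echelon (formalScope 3) gens scopes

/-- `q_{i,k} = (i-1)! / (4^{k-1} (i-k)! (i+k-1)! (1/2)^{rising (k-1)})`, for `1 ≤ k ≤ i`. -/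
def q (i k : ℕ) : ℝ :=
  ((i - 1).factorial : ℝ) /
    (4 ^ (k - 1) * ((i - k).factorial : ℝ) * ((i + k - 1).factorial : ℝ) *
      (ascPochhammer ℝ (k - 1)).eval (1 / 2))

/-- `g_k = x^k ∑_{i ≥ k} q_{i,k} z^i`, for `1 ≤ k`. -/
def gk (k : ℕ) : Ser 3 :=
  X 0 ^ k * (PowerSeries.mk fun i => if k ≤ i then ((q i k : ℝ) : ℂ) else 0).subst (X 2 : Ser 3)

/-- The series `f, h, g_1, …, g_k`. -/
def divisors (k : ℕ) : Fin 2 ⊕ Fin k → Ser 3 := Sum.elim ![f, h] fun j => gk (j.val + 1)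

/-- The scopes of `f, h, g_1, …, g_k`. -/
def divisorScopes (k : ℕ) : Fin 2 ⊕ Fin k → ℕ := Sum.elim ![2, 3] fun _ => 2

/-- The series `f, h, g_1, g_2, …`. -/
def basis : Fin 2 ⊕ ℕ → Ser 3 := Sum.elim ![f, h] fun j => gk (j + 1)

/-- The scopes of `f, h, g_1, g_2, …`. -/
def basisScopes : Fin 2 ⊕ ℕ → ℕ := Sum.elim ![2, 3] fun _ => 2

end

end Gabrielov

/-! ### Initial exponents and uniqueness of echelon division. -/

namespace Echelon

/-! The substitution `x = yz` kills `h` and grades everything by powers of `y` (`blow`). In degree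
`n` an element of the echelon becomes `A + z B (e^z - 1)` with polynomials `A` of degree at most `n`
and `B` of degree below `n` (`exists_blow_eq`), so with `2n + 1` free coefficients. Normality of the
Padé table of the exponential says that such an expression vanishes to order `2n + 1` only if `A = B
= 0` (`pade_exp_unique'`). This one fact gives both the absence of relations (`relation_trivial`)
and the exclusion of initial monomials `x^i z^k` with `k > i` (`initExp_mem_region`).

The remaining initial monomials are supplied by the `g_k`. Modulo `h` one has `yz = x`, so `y
g_{k+1}` becomes `x^{k+2}` times a series in `z` of order `k`. A suitable multiple of `x^2 g_k`
cancels its terms in `z^k` and `z^{k+1}` and leaves `-g_{k+2}`, by the hypergeometric identity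
`q_rec`. The resulting recursion `gk_rec` is already the division of the S-series, and unwinding it
expresses `g_k` by `f, g, h` with convergent cofactors (`gk_eq_cof`).

For the divergence, each cofactor has a coefficient `±1` on a monomial of degree at most `k`, while
`1/q_{k,k}` outgrows every geometric sequence. Since `f, g, h, g_k` are homogeneous in `(x, y)`, the
cofactors of the sum are assembled degree by degree (`glue`) without cancellation. The sum has
bounded coefficients, its cofactors diverge, and uniqueness leaves no convergent alternative. -/

theorem lexOrder_eq_initExp {n : ℕ} {F : Ser n} (hF : F ≠ 0) :
    F.lexOrder = (toLex (initExp F) : Lex (Fin n →₀ ℕ)) := by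
  obtain ⟨d, hd⟩ := exists_finsupp_eq_lexOrder_of_ne_zero hF
  rw [initExp, hd]; rfl

theorem initExp_eq {n : ℕ} {F : Ser n} {d : Fin n →₀ ℕ}
    (h : F.lexOrder = (toLex d : Lex (Fin n →₀ ℕ))) : initExp F = d := by
  rw [initExp, h]; rfl

theorem lexOrder_eq_of_coeff {n : ℕ} {F : Ser n} {d : Fin n →₀ ℕ} (hd : coeff d F ≠ 0)
    (h : ∀ e, coeff e F ≠ 0 → toLex d ≤ toLex e) :
    F.lexOrder = (toLex d : Lex (Fin n →₀ ℕ)) := by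
  refine le_antisymm (lexOrder_le_of_coeff_ne_zero hd) (le_lexOrder_iff.2 fun e he => ?_)
  by_contra hne
  exact absurd (h e hne) (not_le.2 (WithTop.coe_lt_coe.1 he))

theorem coeff_initExp_ne_zero {n : ℕ} {F : Ser n} (hF : F ≠ 0) : coeff (initExp F) F ≠ 0 :=
  coeff_ne_zero_of_lexOrder (lexOrder_eq_initExp hF).symm

theorem initExp_mul {n : ℕ} {F G : Ser n} (hF : F ≠ 0) (hG : G ≠ 0) :
    initExp (F * G) = initExp F + initExp G := by
  apply initExp_eq
  rw [lexOrder_mul, lexOrder_eq_initExp hF, lexOrder_eq_initExp hG]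
  rfl

/-- If the nonzero members of a finite family of series have pairwise distinct initial exponents,
no cancellation of initial terms occurs in their sum. -/
theorem lexOrder_sum_of_distinct {n : ℕ} {κ : Type*} [Fintype κ] (T : κ → Ser n)
    (hT : ∀ i j, i ≠ j → T i ≠ 0 → T j ≠ 0 → (T i).lexOrder ≠ (T j).lexOrder) :
    (∑ i, T i).lexOrder = Finset.univ.inf fun i => (T i).lexOrder := by
  classical
  refine le_antisymm ?_ (le_lexOrder_iff.2 fun d hd => ?_)
  · rcases isEmpty_or_nonempty κ with hκ | hκ
    · simp
    obtain ⟨i, -, hi⟩ := Finset.exists_mem_eq_inf Finset.univ Finset.univ_nonempty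
      (fun i => (T i).lexOrder)
    rw [hi]
    by_cases h0 : T i = 0
    · simp [h0]
    rw [lexOrder_eq_initExp h0]
    apply lexOrder_le_of_coeff_ne_zero
    rw [map_sum, Finset.sum_eq_single i]
    · exact coeff_initExp_ne_zero h0
    · intro j _ hj
      by_cases hj0 : T j = 0
      · simp [hj0]
      apply coeff_eq_zero_of_lt_lexOrder
      have h1 : (T i).lexOrder ≤ (T j).lexOrder := hi ▸ Finset.inf_le (Finset.mem_univ j)
      rw [← lexOrder_eq_initExp h0]
      exact lt_of_le_of_ne h1 (hT i j hj.symm h0 hj0)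
    · simp
  · rw [map_sum]
    refine Finset.sum_eq_zero fun i _ => coeff_eq_zero_of_lt_lexOrder (hd.trans_le ?_)
    exact Finset.inf_le (Finset.mem_univ i)

theorem eq_zero_of_sum_eq_zero_of_distinct {n : ℕ} {κ : Type*} [Fintype κ] (T : κ → Ser n)
    (hT : ∀ i j, i ≠ j → T i ≠ 0 → T j ≠ 0 → (T i).lexOrder ≠ (T j).lexOrder)
    (h0 : ∑ i, T i = 0) (i : κ) : T i = 0 := by
  have h := lexOrder_sum_of_distinct T hT
  rw [h0, lexOrder_zero] at h
  rw [← lexOrder_eq_top_iff_eq_zero]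
  exact top_le_iff.1 (h ▸ Finset.inf_le (Finset.mem_univ i))

section Division

variable {n : ℕ} {ι : Type} {F : ι → Ser n} {s : ι → ℕ} {P : ι → Set (Fin n →₀ ℕ)}

theorem initExp_mul_mem {a F : Ser n} {Q : Set (Fin n →₀ ℕ)} (hF : F ≠ 0)
    (ha : ∀ d, coeff d a ≠ 0 → d + initExp F ∈ Q) (h : a * F ≠ 0) : initExp (a * F) ∈ Q := by
  have ha0 : a ≠ 0 := left_ne_zero_of_mul h
  rw [initExp_mul ha0 hF]
  exact ha _ (coeff_initExp_ne_zero ha0)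

theorem lexOrder_mul_ne (hF : ∀ i, F i ≠ 0) (hP : IsPartition F s P) (a : ι → Ser n)
    (ha : ∀ i d, coeff d (a i) ≠ 0 → d + initExp (F i) ∈ P i) (i j : ι) (hij : i ≠ j)
    (hi : a i * F i ≠ 0) (hj : a j * F j ≠ 0) :
    (a i * F i).lexOrder ≠ (a j * F j).lexOrder := by
  intro h
  have h1 := initExp_mul_mem (hF i) (ha i) hi
  have h2 := initExp_mul_mem (hF j) (ha j) hj
  rw [initExp, h] at h1
  exact Set.disjoint_left.1 (hP.2.1 hij) h1 h2

/-- The condition on initial monomials is automatic: the products `a i * F i` have initial exponents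
in disjoint cells, so nothing cancels. -/
theorem isRemainder_of_eq [Fintype ι] (hF : ∀ i, F i ≠ 0) (hP : IsPartition F s P) {p b : Ser n}
    (a : ι → Ser n) (hs : ∀ i, a i ∈ formalScope n (s i)) (hp : p = ∑ i, a i * F i + b)
    (hb : ∀ d, coeff d b ≠ 0 → d ∉ ⋃ i, region (F i) (s i))
    (ha : ∀ i d, coeff d (a i) ≠ 0 → d + initExp (F i) ∈ P i) : IsRemainder F s P p b := by
  refine ⟨a, hs, hp, hb, ha, ?_⟩
  rw [hp, add_sub_cancel_right, lexOrder_sum_of_distinct _ (lexOrder_mul_ne hF hP a ha)]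
  simp_rw [lexOrder_mul]

/-- In the difference of two divisions, the nonzero products start in disjoint cells and a nonzero
difference of remainders starts outside all regions. A vanishing sum of such terms has only zero
terms. -/
theorem IsRemainder.unique [Fintype ι] (hF : ∀ i, F i ≠ 0) (hP : IsPartition F s P) {p b b' : Ser n}
    (h : IsRemainder F s P p b) (h' : IsRemainder F s P p b') : b = b' := by
  obtain ⟨a, -, hp, hb, ha, -⟩ := h
  obtain ⟨a', -, hp', hb', ha', -⟩ := h'
  have hc : ∀ i d, coeff d (a i - a' i) ≠ 0 → d + initExp (F i) ∈ P i := by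
    intro i d hd
    by_cases h : coeff d (a i) = 0
    · exact ha' i d fun h' => hd (by rw [map_sub, h, h', sub_zero])
    · exact ha i d h
  have hd : ∀ d, coeff d (b - b') ≠ 0 → d ∉ ⋃ i, region (F i) (s i) := by
    intro d hd
    by_cases h : coeff d b = 0
    · exact hb' d fun h' => hd (by rw [map_sub, h, h', sub_zero])
    · exact hb d h
  let T : Option ι → Ser n := fun o => o.elim (b - b') fun i => (a i - a' i) * F i
  have hsum : ∑ o, T o = 0 := by
    rw [Fintype.sum_option]
    simp only [T, Option.elim, sub_mul, Finset.sum_sub_distrib]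
    linear_combination hp' - hp
  have key : ∀ i, b - b' ≠ 0 → (a i - a' i) * F i ≠ 0 →
      (b - b').lexOrder ≠ ((a i - a' i) * F i).lexOrder := by
    intro i h1 h2 h3
    have h4 := initExp_mul_mem (hF i) (hc i) h2
    have h5 := hd _ (coeff_initExp_ne_zero h1)
    rw [initExp, h3] at h5
    exact h5 (Set.mem_iUnion.2 ⟨i, hP.1 i h4⟩)
  refine sub_eq_zero.1 (eq_zero_of_sum_eq_zero_of_distinct T ?_ hsum none)
  rintro (_ | i) (_ | j) hij h1 h2
  · exact absurd rfl hij
  · exact key j h1 h2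
  · exact (key i h2 h1).symm
  · exact lexOrder_mul_ne hF hP _ hc i j (fun h => hij (congrArg some h)) h1 h2

/-- This makes the divisions below independent of the partition: only exponents lying in a single
region are ever used by the quotients. -/
theorem IsPartition.mem_of_unique (hP : IsPartition F s P) {i : ι} {d : Fin n →₀ ℕ}
    (hi : d ∈ region (F i) (s i)) (h : ∀ j, d ∈ region (F j) (s j) → j = i) : d ∈ P i := by
  have h1 : d ∈ ⋃ j, P j := by
    rw [hP.2.2]; exact Set.mem_iUnion.2 ⟨i, hi⟩
  obtain ⟨j, hj⟩ := Set.mem_iUnion.1 h1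
  rwa [← h j (hP.1 j hj)]

end Division

/-! ### Products and monomials in scoped and convergent series. -/

section Algebra

variable {n : ℕ}

theorem IsConvergent.mul {F G : Ser n} (hF : IsConvergent F) (hG : IsConvergent G) :
    IsConvergent (F * G) := by
  obtain ⟨r, hr, hF⟩ := hF
  obtain ⟨t, ht, hG⟩ := hG
  have h0 : 0 < min r t := lt_min hr ht
  have hF' : Summable (fun d : Fin n →₀ ℕ => ‖coeff d F‖ * min r t ^ d.degree) :=
    Summable.of_nonneg_of_le (fun d => by positivity)
      (fun d => mul_le_mul_of_nonneg_left (pow_le_pow_left₀ h0.le (min_le_left _ _) _)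
        (norm_nonneg _)) hF
  have hG' : Summable (fun d : Fin n →₀ ℕ => ‖coeff d G‖ * min r t ^ d.degree) :=
    Summable.of_nonneg_of_le (fun d => by positivity)
      (fun d => mul_le_mul_of_nonneg_left (pow_le_pow_left₀ h0.le (min_le_right _ _) _)
        (norm_nonneg _)) hG
  set u : (Fin n →₀ ℕ) → ℝ := fun d => ‖coeff d F‖ * min r t ^ d.degree with hu
  set v : (Fin n →₀ ℕ) → ℝ := fun d => ‖coeff d G‖ * min r t ^ d.degree with hv
  have hu0 : 0 ≤ u := fun d => by positivity
  have hv0 : 0 ≤ v := fun d => by positivity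
  have h := summable_sum_mul_antidiagonal_of_summable_mul (hF'.mul_of_nonneg hG' hu0 hv0)
  refine ⟨min r t, h0, Summable.of_nonneg_of_le (fun d => by positivity) (fun d => ?_) h⟩
  rw [coeff_mul]
  calc _ ≤ (∑ p ∈ Finset.HasAntidiagonal.antidiagonal d, ‖coeff p.1 F * coeff p.2 G‖) * min r t ^ d.degree :=
        mul_le_mul_of_nonneg_right (norm_sum_le _ _) (by positivity)
    _ = ∑ p ∈ Finset.HasAntidiagonal.antidiagonal d, u p.1 * v p.2 := by
        rw [Finset.sum_mul]
        refine Finset.sum_congr rfl fun p hp => ?_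
        simp only [hu, hv]
        rw [← Finset.HasAntidiagonal.mem_antidiagonal.1 hp, map_add, pow_add, norm_mul]
        ring

theorem formalScope_mul {s : ℕ} {F G : Ser n} (hF : F ∈ formalScope n s)
    (hG : G ∈ formalScope n s) : F * G ∈ formalScope n s := by
  intro d hd
  rw [coeff_mul] at hd
  obtain ⟨p, hp, hne⟩ := Finset.exists_ne_zero_of_sum_ne_zero hd
  intro i hi
  rw [← Finset.HasAntidiagonal.mem_antidiagonal.1 hp, Finsupp.add_apply,
    hF _ (left_ne_zero_of_mul hne) i hi, hG _ (right_ne_zero_of_mul hne) i hi]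

theorem convScope_mul {s : ℕ} {F G : Ser n} (hF : F ∈ convScope n s)
    (hG : G ∈ convScope n s) : F * G ∈ convScope n s :=
  ⟨formalScope_mul hF.1 hG.1, hF.2.mul hG.2⟩

theorem isConvergent_monomial (d : Fin n →₀ ℕ) (c : ℂ) : IsConvergent (monomial d c : Ser n) := by
  classical
  refine ⟨1, one_pos, summable_of_ne_finset_zero (s := {d}) fun e he => ?_⟩
  rw [coeff_monomial_ne (by simpa using he)]
  simp

theorem monomial_mem_formalScope {s : ℕ} {d : Fin n →₀ ℕ} (hd : d ∈ scopeExponents n s) (c : ℂ) :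
    (monomial d c : Ser n) ∈ formalScope n s := by
  intro e he
  rwa [eq_of_coeff_monomial_ne_zero he]

theorem monomial_mem_convScope {s : ℕ} {d : Fin n →₀ ℕ} (hd : d ∈ scopeExponents n s) (c : ℂ) :
    (monomial d c : Ser n) ∈ convScope n s :=
  ⟨monomial_mem_formalScope hd c, isConvergent_monomial d c⟩

theorem X_mem_convScope {s : ℕ} (i : Fin n) (hi : i.val < s) : (X i : Ser n) ∈ convScope n s := by
  refine monomial_mem_convScope (fun j hj => ?_) 1
  rw [Finsupp.single_eq_of_ne]
  rintro rfl
  omega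

theorem formalScope_mono {s t : ℕ} (h : s ≤ t) : formalScope n s ≤ formalScope n t :=
  fun _ hF d hd i hi => hF d hd i (h.trans hi)

theorem convScope_mono {s t : ℕ} (h : s ≤ t) : convScope n s ≤ convScope n t :=
  inf_le_inf_right _ (formalScope_mono h)

theorem mem_formalScope_self (F : Ser n) : F ∈ formalScope n n := by
  intro d _ i hi
  exact absurd i.isLt (not_lt.2 hi)

theorem mem_summand {R : Submodule ℂ (Ser n)} {F G : Ser n} :
    G ∈ summand R F ↔ ∃ a ∈ R, a * F = G := by
  rw [summand, Submodule.mem_map]; rfl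

theorem region_subset_initialExponents {R : ℕ → Submodule ℂ (Ser n)} {I : Submodule ℂ (Ser n)}
    {G : Ser n} {t : ℕ} (hG : G ≠ 0) (h : summand (R t) G ≤ I)
    (hR : ∀ d ∈ scopeExponents n t, (monomial d 1 : Ser n) ∈ R t) :
    region G t ⊆ initialExponents I := by
  rintro d ⟨v, hv, rfl⟩
  have hm : (monomial v 1 : Ser n) ≠ 0 := by
    intro h0
    have := congrArg (coeff v) h0
    simp at this
  refine ⟨monomial v 1 * G, h (mem_summand.2 ⟨_, hR v hv, rfl⟩), mul_ne_zero hm hG, ?_⟩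
  rw [initExp_mul hm hG, add_comm, initExp_eq (F := monomial v 1)]
  refine lexOrder_eq_of_coeff (by simp) fun e he => ?_
  rw [eq_of_coeff_monomial_ne_zero he]

end Algebra

end Echelon

/-! ### The coefficients `q_{i,k}`: recursions and size. -/

namespace Gabrielov

open Echelon

theorem ascPochhammer_half_pos (s : ℕ) : 0 < (ascPochhammer ℝ s).eval (1 / 2) :=
  ascPochhammer_pos s _ (by norm_num)

theorem q_add (s t : ℕ) : q (s + 1 + t) (s + 1) = ((s + t).factorial : ℝ) /
    (4 ^ s * (t.factorial : ℝ) * ((2 * s + 1 + t).factorial : ℝ) *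
      (ascPochhammer ℝ s).eval (1 / 2)) := by
  have h1 : s + 1 + t - 1 = s + t := by omega
  have h2 : s + 1 + t - (s + 1) = t := by omega
  have h3 : s + 1 + t + (s + 1) - 1 = 2 * s + 1 + t := by omega
  rw [q, h1, h2, h3, Nat.add_sub_cancel]

theorem q_pos {i k : ℕ} (hk : 1 ≤ k) (hi : k ≤ i) : 0 < q i k := by
  obtain ⟨s, rfl⟩ := Nat.exists_eq_add_of_le' hk
  obtain ⟨t, rfl⟩ := Nat.exists_eq_add_of_le hi
  rw [q_add]
  have := ascPochhammer_half_pos s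
  positivity

theorem q_self_pos {k : ℕ} (hk : 1 ≤ k) : 0 < q k k := q_pos hk le_rfl

theorem q_one {i : ℕ} (hi : 1 ≤ i) : q i 1 = 1 / (i.factorial : ℝ) := by
  obtain ⟨t, rfl⟩ := Nat.exists_eq_add_of_le hi
  have h := q_add 0 t
  simp only [zero_add, mul_zero, pow_zero, one_mul, ascPochhammer_zero, Polynomial.eval_one,
    mul_one] at h
  rw [h]
  have : (t.factorial : ℝ) ≠ 0 := by positivity
  field_simp

theorem q_self_succ {k : ℕ} (hk : 1 ≤ k) : q (k + 1) (k + 1) / q k k =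
    1 / (4 * (2 * (k : ℝ) + 1) * (2 * (k : ℝ) - 1)) := by
  obtain ⟨s, rfl⟩ := Nat.exists_eq_add_of_le' hk
  have h1 := q_add (s + 1) 0
  have h2 := q_add s 0
  simp only [add_zero] at h1 h2
  rw [h1, h2, ascPochhammer_succ_eval]
  have hp := (ascPochhammer_half_pos s).ne'
  rw [show 2 * (s + 1) + 1 = 2 * s + 1 + 1 + 1 by ring, Nat.factorial_succ (2 * s + 1 + 1),
    Nat.factorial_succ (2 * s + 1), Nat.factorial_succ s]
  have e1 : (s.factorial : ℝ) ≠ 0 := by positivity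
  have e2 : ((2 * s + 1).factorial : ℝ) ≠ 0 := by positivity
  have e3 : 2 * ((s : ℝ) + 1) - 1 = 2 * s + 1 := by ring
  have e4 : (1 / 2 + (s : ℝ)) ≠ 0 := by positivity
  push_cast
  rw [e3]
  generalize Polynomial.eval (1 / 2 : ℝ) (ascPochhammer ℝ s) = p at *
  field_simp
  ring

theorem q_succ_mul {i k : ℕ} (hk : 1 ≤ k) (hi : k ≤ i) :
    q (i + 1) k * (((i : ℝ) + 1 - k) * (i + k)) = i * q i k := by
  obtain ⟨s, rfl⟩ := Nat.exists_eq_add_of_le' hk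
  obtain ⟨t, rfl⟩ := Nat.exists_eq_add_of_le hi
  rw [add_assoc (s + 1), q_add, q_add]
  have hp := (ascPochhammer_half_pos s).ne'
  rw [← add_assoc, ← add_assoc, Nat.factorial_succ (s + t), Nat.factorial_succ t,
    Nat.factorial_succ (2 * s + 1 + t)]
  have e1 : (t.factorial : ℝ) ≠ 0 := by positivity
  have e2 : ((2 * s + 1 + t).factorial : ℝ) ≠ 0 := by positivity
  push_cast
  generalize Polynomial.eval (1 / 2 : ℝ) (ascPochhammer ℝ s) = p at *
  field_simp
  ring

/-- Consecutive coefficients have ratio `i / ((i+1-k)(i+k))`, which is at most `1` for `i ≥ k ≥ 1`.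
-/
theorem q_le {i k : ℕ} (hk : 1 ≤ k) (hi : k ≤ i) : q i k ≤ q k k := by
  induction i, hi using Nat.le_induction with
  | base => exact le_rfl
  | succ i hi ih =>
    refine le_trans ?_ ih
    have h := q_succ_mul hk hi
    have h0 := q_pos hk (hi.trans (Nat.le_succ i))
    have h1 := q_pos hk hi
    have hi' : (k : ℝ) ≤ i := by exact_mod_cast hi
    have hk' : (1 : ℝ) ≤ k := by exact_mod_cast hk
    have hi0 : (0 : ℝ) < i := by linarith
    refine le_of_mul_le_mul_left (a := (i : ℝ)) ?_ hi0
    rw [← h, mul_comm]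
    refine mul_le_mul_of_nonneg_left ?_ h0.le
    nlinarith

/-- The three-term recursion of the coefficients `q`. -/
theorem q_rec {j k : ℕ} (hk : 1 ≤ k) (hj : k + 2 ≤ j) :
    q j (k + 2) = q (k + 1) (k + 1) / q k k * q j k - q (j + 1) (k + 1) := by
  rw [q_self_succ hk]
  obtain ⟨s, rfl⟩ := Nat.exists_eq_add_of_le' hk
  obtain ⟨t, rfl⟩ := Nat.exists_eq_add_of_le hj
  -- With `k = s+1` and `j = s+3+t`, everything is reduced to `t!`, `(s+t+2)!`, `(2s+t+3)!` and one
  -- Pochhammer value; a rational identity remains.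
  have h1 := q_add (s + 2) t
  have h2 := q_add s (t + 2)
  have h3 := q_add (s + 1) (t + 2)
  rw [show s + 1 + 2 + t = s + 2 + 1 + t by ring, show s + 1 + 2 = s + 2 + 1 by ring, h1,
    show s + 2 + 1 + t = s + 1 + (t + 2) by ring, h2,
    show s + 1 + (t + 2) + 1 = s + 1 + 1 + (t + 2) by ring, h3,
    ascPochhammer_succ_eval, ascPochhammer_succ_eval]
  have hp := (ascPochhammer_half_pos s).ne'
  rw [show s + 2 + t = s + t + 2 by ring, show s + (t + 2) = s + t + 2 by ring,
    show s + 1 + (t + 2) = s + t + 2 + 1 by ring, Nat.factorial_succ (s + t + 2),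
    show 2 * (s + 2) + 1 + t = 2 * s + t + 3 + 1 + 1 by ring,
    show 2 * (s + 1) + 1 + (t + 2) = 2 * s + t + 3 + 1 + 1 by ring,
    show 2 * s + 1 + (t + 2) = 2 * s + t + 3 by ring,
    Nat.factorial_succ (2 * s + t + 3 + 1), Nat.factorial_succ (2 * s + t + 3),
    Nat.factorial_succ (t + 1), Nat.factorial_succ t]
  have e1 : (t.factorial : ℝ) ≠ 0 := by positivity
  have e2 : ((2 * s + t + 3).factorial : ℝ) ≠ 0 := by positivity
  have e3 : 2 * ((s : ℝ) + 1) - 1 = 2 * s + 1 := by ring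
  have e4 : (1 / 2 + (s : ℝ)) ≠ 0 := by positivity
  have e5 : (1 / 2 + ((s : ℝ) + 1)) ≠ 0 := by positivity
  push_cast
  rw [e3]
  generalize Polynomial.eval (1 / 2 : ℝ) (ascPochhammer ℝ s) = p at *
  field_simp
  ring

theorem q_succ_self {k : ℕ} (hk : 1 ≤ k) : q (k + 1) k = q k k / 2 := by
  have h := q_succ_mul hk le_rfl
  have hk' : (k : ℝ) ≠ 0 := by positivity
  refine mul_left_cancel₀ hk' ?_
  linear_combination h / 2

/-- A crude form of the ratio formula, sufficient to beat every geometric growth. -/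
theorem q_self_le (k : ℕ) : q (k + 1) (k + 1) ≤ 1 / (k.factorial : ℝ) := by
  induction k with
  | zero => simp [q]
  | succ k ih =>
    have h0 := q_self_pos (Nat.le_add_left 1 k)
    have h := (div_eq_iff h0.ne').1 (q_self_succ (Nat.le_add_left 1 k))
    rw [h, Nat.factorial_succ]
    push_cast
    rw [show 1 / (((k : ℝ) + 1) * (k.factorial : ℝ)) = 1 / ((k : ℝ) + 1) * (1 / (k.factorial : ℝ)) by
      rw [one_div_mul_one_div]]
    refine mul_le_mul ?_ ih h0.le (by positivity)
    have : (0 : ℝ) ≤ k := by positivity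
    refine one_div_le_one_div_of_le (by positivity) ?_
    nlinarith

open Filter Topology in
theorem tendsto_pow_mul_q (ρ : ℝ) : Tendsto (fun k : ℕ => ρ ^ k * q k k) atTop (𝓝 0) := by
  rw [← tendsto_add_atTop_iff_nat 1]
  have h := (FloorSemiring.tendsto_pow_div_factorial_atTop |ρ|).const_mul |ρ|
  rw [mul_zero] at h
  refine squeeze_zero_norm (fun k => ?_) h
  have h0 := q_self_pos (Nat.le_add_left 1 k)
  rw [norm_mul, norm_pow, Real.norm_eq_abs, Real.norm_eq_abs, abs_of_pos h0, pow_succ']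
  calc _ ≤ |ρ| * |ρ| ^ k * (1 / (k.factorial : ℝ)) :=
        mul_le_mul_of_nonneg_left (q_self_le k) (by positivity)
    _ = _ := by ring

/-! ### Generating series in `z` and their recursion. -/

/-- The series `∑_{i ≥ k} q_{i,k} z^i`. -/
noncomputable def qSeries (k : ℕ) : PowerSeries ℂ :=
  PowerSeries.mk fun i => if k ≤ i then ((q i k : ℝ) : ℂ) else 0

/-- The series `∑_{i ≥ k} q_{i,k} z^{i-1}`. -/
noncomputable def qShift (k : ℕ) : PowerSeries ℂ :=
  PowerSeries.mk fun i => if k ≤ i + 1 then ((q (i + 1) k : ℝ) : ℂ) else 0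

/-- The split-off factor `z` combines with `y` to give `x` modulo `h`. -/
theorem qSeries_eq {k : ℕ} (hk : 1 ≤ k) : qSeries k = PowerSeries.X * qShift k := by
  ext (_ | i)
  · simp [qSeries, Nat.one_le_iff_ne_zero.1 hk]
  · rw [PowerSeries.coeff_succ_X_mul]
    simp [qSeries, qShift]

theorem qSeries_one : qSeries 1 = PowerSeries.exp ℂ - 1 := by
  ext (_ | i)
  · simp [qSeries]
  · simp [qSeries, PowerSeries.coeff_exp, PowerSeries.coeff_one, q_one]

/-- Start of the recursion: there is no `g_0`, and the constant `1`, coming from `f`, takes its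
place. The terms in `z^0` and `z^1` cancel. -/
theorem qSeries_two : qSeries 2 = 1 + PowerSeries.C (1 / 2) * qSeries 1 - qShift 1 := by
  ext i
  rw [map_sub, map_add, PowerSeries.coeff_C_mul, PowerSeries.coeff_one]
  simp only [qSeries, qShift, PowerSeries.coeff_mk]
  rcases i with _ | _ | i
  · simp [q_one]
  · simp [q_one, Nat.factorial]
  · rw [if_pos (by omega), if_neg (by omega), if_pos (by omega), if_pos (by omega),
      q_one (by omega), q_one (by omega)]
    have h := q_add 1 i
    have h1 : (ascPochhammer ℝ 1).eval (1 / 2) = 1 / 2 := by simp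
    rw [show i + 1 + 1 = 1 + 1 + i by ring, h, h1,
      show 1 + 1 + i + 1 = i + 2 + 1 by ring, show 2 * 1 + 1 + i = i + 2 + 1 by ring,
      show 1 + 1 + i = i + 1 + 1 by ring, show 1 + i = i + 1 by ring,
      Nat.factorial_succ (i + 2), Nat.factorial_succ (i + 1), Nat.factorial_succ i]
    have e1 : (i.factorial : ℂ) ≠ 0 := by exact_mod_cast Nat.factorial_ne_zero i
    have e2 : (i : ℂ) + 1 ≠ 0 := by exact_mod_cast Nat.succ_ne_zero i
    have e3 : (i : ℂ) + 1 + 1 ≠ 0 := by exact_mod_cast Nat.succ_ne_zero (i + 1)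
    have e4 : (i : ℂ) + 2 + 1 ≠ 0 := by exact_mod_cast Nat.succ_ne_zero (i + 2)
    push_cast
    field_simp
    ring

/-- The constant is chosen to cancel `z^k`. The term `z^{k+1}` then cancels by itself, since the
second coefficient is half the first for both series; higher terms are `q_rec`. -/
theorem qSeries_rec {k : ℕ} (hk : 1 ≤ k) : qSeries (k + 2) =
    PowerSeries.C ((q (k + 1) (k + 1) / q k k : ℝ) : ℂ) * qSeries k - qShift (k + 1) := by
  ext j
  rw [map_sub, PowerSeries.coeff_C_mul]
  simp only [qSeries, qShift, PowerSeries.coeff_mk]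
  have h0 := (q_self_pos hk).ne'
  rcases lt_trichotomy j (k + 1) with hj | rfl | hj
  · rw [if_neg (by omega)]
    rcases lt_or_eq_of_le (Nat.lt_succ_iff.1 hj) with hj | rfl
    · rw [if_neg (by omega), if_neg (by omega)]
      simp
    · rw [if_pos le_rfl, if_pos le_rfl, ← Complex.ofReal_mul, div_mul_cancel₀ _ h0, sub_self]
  · rw [if_neg (by omega), if_pos (by omega), if_pos (by omega), ← Complex.ofReal_mul,
      q_succ_self (by omega : 1 ≤ k + 1), q_succ_self hk, ← Complex.ofReal_sub,
      ← Complex.ofReal_zero]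
    congr 1
    field_simp
    ring
  · rw [if_pos (by omega), if_pos (by omega), if_pos (by omega), q_rec hk (by omega)]
    push_cast
    rfl

/-! ### Padé uniqueness for the exponential. -/

/-- If `P + Q eᶻ` vanishes to order `a + b`, where `deg P < a` and `deg Q < b`, then
`P = Q = 0`. -/
theorem pade_exp_unique (a : ℕ) : ∀ (b : ℕ) (P Q : PowerSeries ℂ),
    (∀ n, a ≤ n → PowerSeries.coeff n P = 0) → (∀ n, b ≤ n → PowerSeries.coeff n Q = 0) →
    (∀ n, n < a + b → PowerSeries.coeff n (P + Q * PowerSeries.exp ℂ) = 0) → P = 0 ∧ Q = 0 := by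
  induction a with
  | zero =>
    intro b P Q hP hQ h
    have hP0 : P = 0 := PowerSeries.ext fun n => hP n (Nat.zero_le n)
    subst hP0
    refine ⟨rfl, PowerSeries.ext fun n => ?_⟩
    rcases le_or_gt b n with hn | hn
    · exact hQ n hn
    have h1 : PowerSeries.X ^ b ∣ Q * PowerSeries.exp ℂ := by
      rw [PowerSeries.X_pow_dvd_iff]
      intro m hm
      simpa using h m (by omega)
    have h2 : Q = Q * PowerSeries.exp ℂ * PowerSeries.evalNegHom (PowerSeries.exp ℂ) := by
      rw [mul_assoc, PowerSeries.exp_mul_exp_neg_eq_one, mul_one]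
    have h3 : PowerSeries.X ^ b ∣ Q := by
      rw [h2]; exact h1.mul_right _
    exact PowerSeries.X_pow_dvd_iff.1 h3 n hn
  | succ a ih =>
    intro b P Q hP hQ h
    have hd : PowerSeries.derivative ℂ (PowerSeries.exp ℂ) = PowerSeries.exp ℂ :=
      PowerSeries.derivative_exp ℂ
    -- Differentiation lowers the degree bound of `P` and the order of vanishing by one, and keeps
    -- the bound `b` for the factor of `e^z`.
    have h1 := ih b (PowerSeries.derivative ℂ P) (Q + PowerSeries.derivative ℂ Q)
      (fun n hn => by
        rw [PowerSeries.coeff_derivative, hP _ (by omega), zero_mul])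
      (fun n hn => by
        rw [map_add, PowerSeries.coeff_derivative, hQ _ hn, hQ _ (by omega), zero_mul, add_zero])
      (fun n hn => by
        have h2 : PowerSeries.derivative ℂ P +
            (Q + PowerSeries.derivative ℂ Q) * PowerSeries.exp ℂ =
            PowerSeries.derivative ℂ (P + Q * PowerSeries.exp ℂ) := by
          rw [map_add, Derivation.leibniz, hd, smul_eq_mul, smul_eq_mul]
          ring
        rw [h2, PowerSeries.coeff_derivative, h _ (by omega), zero_mul])
    -- From `Q + Q' = 0`, vanishing of a coefficient passes to the one below; the start is the
    -- degree bound.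
    have hQ0 : ∀ m n, b ≤ n + m → PowerSeries.coeff n Q = 0 := by
      intro m
      induction m with
      | zero => exact fun n hn => hQ n hn
      | succ m ihm =>
        intro n hn
        have h3 := congrArg (PowerSeries.coeff n) h1.2
        rw [map_add, PowerSeries.coeff_derivative, ihm (n + 1) (by omega), zero_mul, add_zero] at h3
        simpa using h3
    have hQz : Q = 0 := PowerSeries.ext fun n => hQ0 b n (by omega)
    subst hQz
    refine ⟨PowerSeries.ext fun n => ?_, rfl⟩
    rcases n with _ | n
    · simpa using h 0 (by omega)
    · have h3 := congrArg (PowerSeries.coeff n) h1.1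
      rw [PowerSeries.coeff_derivative, map_zero] at h3
      have h4 : (n : ℂ) + 1 ≠ 0 := by exact_mod_cast Nat.succ_ne_zero n
      simpa [h4] using h3

/-- If `A + z B (eᶻ - 1)` vanishes to order `2n + 1`, where `deg A ≤ n` and `deg B < n`, then
`A = B = 0`. -/
theorem pade_exp_unique' {n : ℕ} {A B : PowerSeries ℂ}
    (hA : ∀ i, n < i → PowerSeries.coeff i A = 0) (hB : ∀ i, n ≤ i → PowerSeries.coeff i B = 0)
    (h : ∀ i, i < 2 * n + 1 →
      PowerSeries.coeff i (A + PowerSeries.X * B * (PowerSeries.exp ℂ - 1)) = 0) :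
    A = 0 ∧ B = 0 := by
  have h0 : PowerSeries.X ∣ A := by
    rw [PowerSeries.X_dvd_iff]
    have := h 0 (by omega)
    simpa using this
  obtain ⟨A', rfl⟩ := h0
  -- After division by `z`, the expression is `(A' - B) + B e^z`, vanishing to order `2n`.
  have h1 := pade_exp_unique n n (A' - B) B
    (fun i hi => by
      have h2 := hA (i + 1) (by omega)
      rw [PowerSeries.coeff_succ_X_mul] at h2
      rw [map_sub, h2, hB i hi, sub_zero]) hB
    (fun i hi => by
      have h2 := h (i + 1) (by omega)
      rw [mul_assoc, ← mul_add, PowerSeries.coeff_succ_X_mul] at h2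
      rw [← h2]
      congr 1
      ring)
  obtain ⟨h2, rfl⟩ := h1
  rw [sub_zero] at h2
  simp [h2]

end Gabrielov

/-! ### Series in three variables and the substitution `x = yz`. -/

namespace Echelon

theorem fin3_lex_lt_iff {d e : Fin 3 →₀ ℕ} : toLex d < toLex e ↔
    d 0 < e 0 ∨ d 0 = e 0 ∧ (d 1 < e 1 ∨ d 1 = e 1 ∧ d 2 < e 2) := by
  rw [Finsupp.Lex.lt_iff]
  simp only [Fin.exists_fin_succ, Fin.forall_fin_succ]
  simp
  tauto

theorem fin3_lex_le_iff {d e : Fin 3 →₀ ℕ} : toLex d ≤ toLex e ↔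
    d 0 < e 0 ∨ d 0 = e 0 ∧ (d 1 < e 1 ∨ d 1 = e 1 ∧ d 2 ≤ e 2) := by
  rw [← not_lt, fin3_lex_lt_iff]
  omega

theorem fin3_ext {d e : Fin 3 →₀ ℕ} (h0 : d 0 = e 0) (h1 : d 1 = e 1) (h2 : d 2 = e 2) :
    d = e := by
  ext i
  fin_cases i <;> assumption

/-- The exponent of `x^i y^j z^k`. -/
noncomputable def expo (i j k : ℕ) : Fin 3 →₀ ℕ :=
  Finsupp.single 0 i + Finsupp.single 1 j + Finsupp.single 2 k

@[simp] theorem expo_zero (i j k : ℕ) : expo i j k 0 = i := by simp [expo]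
@[simp] theorem expo_one (i j k : ℕ) : expo i j k 1 = j := by simp [expo]
@[simp] theorem expo_two (i j k : ℕ) : expo i j k 2 = k := by simp [expo]

theorem expo_self (d : Fin 3 →₀ ℕ) : expo (d 0) (d 1) (d 2) = d :=
  fin3_ext (by simp) (by simp) (by simp)

theorem mem_scopeExponents_two {d : Fin 3 →₀ ℕ} : d ∈ scopeExponents 3 2 ↔ d 2 = 0 := by
  refine ⟨fun h => h 2 le_rfl, fun h i hi => ?_⟩
  have : i = 2 := Fin.ext (by omega)
  rwa [this]

theorem mem_scopeExponents_three (d : Fin 3 →₀ ℕ) : d ∈ scopeExponents 3 3 :=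
  fun i hi => absurd i.isLt (not_lt.2 hi)

theorem coeff_X_pow_mul_eq (s : Fin 3) (n : ℕ) (F : Ser 3) (d : Fin 3 →₀ ℕ) :
    coeff d (X s ^ n * F) = if n ≤ d s then coeff (d - Finsupp.single s n) F else 0 := by
  rw [X_pow_eq, coeff_monomial_mul]
  simp only [Finsupp.single_le_iff, one_mul]

theorem coeff_X_mul_eq (s : Fin 3) (F : Ser 3) (d : Fin 3 →₀ ℕ) :
    coeff d (X s * F) = if 1 ≤ d s then coeff (d - Finsupp.single s 1) F else 0 := by
  rw [← coeff_X_pow_mul_eq, pow_one]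

/-- A power series in one variable, as a power series in `z`. -/
noncomputable def inZ (u : PowerSeries ℂ) : Ser 3 := u.subst (X 2 : Ser 3)

theorem hasSubst_z : PowerSeries.HasSubst (X 2 : Ser 3) := PowerSeries.HasSubst.X 2

theorem coeff_inZ (u : PowerSeries ℂ) (d : Fin 3 →₀ ℕ) :
    coeff d (inZ u) = if d 0 = 0 ∧ d 1 = 0 then PowerSeries.coeff (d 2) u else 0 := by
  rw [inZ, PowerSeries.coeff_subst_single]
  congr 1
  refine propext ⟨fun h => ?_, fun h => fin3_ext (by simp [h.1]) (by simp [h.2]) (by simp)⟩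
  rw [h]
  simp

theorem inZ_add (u v : PowerSeries ℂ) : inZ (u + v) = inZ u + inZ v :=
  PowerSeries.subst_add hasSubst_z u v

theorem inZ_sub (u v : PowerSeries ℂ) : inZ (u - v) = inZ u - inZ v :=
  PowerSeries.subst_sub hasSubst_z u v

theorem inZ_mul (u v : PowerSeries ℂ) : inZ (u * v) = inZ u * inZ v :=
  PowerSeries.subst_mul hasSubst_z u v

theorem inZ_X : inZ PowerSeries.X = X 2 := PowerSeries.subst_X hasSubst_z

theorem inZ_C (c : ℂ) : inZ (PowerSeries.C c) = C c := PowerSeries.subst_C c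

theorem inZ_one : inZ 1 = 1 := by
  rw [← map_one (PowerSeries.C (R := ℂ)), inZ_C, map_one]

/-- The coefficient of `x^i y^j`, as a power series in `z`. -/
noncomputable def row (i j : ℕ) (F : Ser 3) : PowerSeries ℂ :=
  PowerSeries.mk fun k => coeff (expo i j k) F

theorem coeff_row (i j k : ℕ) (F : Ser 3) :
    PowerSeries.coeff k (row i j F) = coeff (expo i j k) F := PowerSeries.coeff_mk _ _

theorem row_add (i j : ℕ) (F G : Ser 3) : row i j (F + G) = row i j F + row i j G := by
  ext k
  simp [coeff_row]

theorem row_inZ_mul (i j : ℕ) (u : PowerSeries ℂ) (F : Ser 3) :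
    row i j (inZ u * F) = u * row i j F := by
  classical
  ext k
  rw [coeff_row, coeff_mul, PowerSeries.coeff_mul]
  symm
  -- Only splittings whose first part is a pure power of `z` contribute, because `inZ u` involves no
  -- other monomials.
  refine Finset.sum_of_injOn (fun p : ℕ × ℕ => (expo 0 0 p.1, expo i j p.2)) ?_ ?_ ?_ ?_
  · rintro ⟨a, b⟩ - ⟨a', b'⟩ - h
    simp only [Prod.mk.injEq] at h
    have h1 := DFunLike.congr_fun h.1 2
    have h2 := DFunLike.congr_fun h.2 2
    simp only [expo_two] at h1 h2
    rw [h1, h2]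
  · rintro ⟨a, b⟩ h
    have h' : a + b = k := by simpa using h
    simp only [Finset.mem_coe, Finset.HasAntidiagonal.mem_antidiagonal]
    exact fin3_ext (by simp) (by simp) (by simpa using h')
  · rintro ⟨a, b⟩ h hn
    simp only [Finset.HasAntidiagonal.mem_antidiagonal] at h
    simp only
    rw [coeff_inZ]
    split_ifs with h0
    · refine absurd ⟨(a 2, b 2), ?_, ?_⟩ hn
      · have := DFunLike.congr_fun h 2
        simpa using this
      · have h1 := DFunLike.congr_fun h 0
        have h2 := DFunLike.congr_fun h 1
        simp only [Finsupp.add_apply, h0, zero_add, expo_zero, expo_one] at h1 h2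
        simp only [Prod.mk.injEq]
        exact ⟨fin3_ext (by simp [h0]) (by simp [h0]) (by simp),
          fin3_ext (by simp [h1]) (by simp [h2]) (by simp)⟩
    · rw [zero_mul]
  · rintro ⟨a, b⟩ h
    simp only
    rw [coeff_inZ, coeff_row]
    simp

theorem row_X_zero_mul (i j : ℕ) (F : Ser 3) : row (i + 1) j (X 0 * F) = row i j F := by
  ext k
  rw [coeff_row, coeff_row, coeff_X_mul_eq, if_pos (by simp),
    show expo (i + 1) j k - Finsupp.single 0 1 = expo i j k from
      fin3_ext (by simp) (by simp) (by simp)]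

theorem row_zero_X_zero_mul (j : ℕ) (F : Ser 3) : row 0 j (X 0 * F) = 0 := by
  ext k
  rw [coeff_row, coeff_X_mul_eq, if_neg (by simp), map_zero]

theorem row_X_one_mul (i j : ℕ) (F : Ser 3) : row i (j + 1) (X 1 * F) = row i j F := by
  ext k
  rw [coeff_row, coeff_row, coeff_X_mul_eq, if_pos (by simp),
    show expo i (j + 1) k - Finsupp.single 1 1 = expo i j k from
      fin3_ext (by simp) (by simp) (by simp)]

theorem row_zero_X_one_mul (i : ℕ) (F : Ser 3) : row i 0 (X 1 * F) = 0 := by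
  ext k
  rw [coeff_row, coeff_X_mul_eq, if_neg (by simp), map_zero]

/-- The coefficient of `y^n` in `F(yz, y, z)`, as a power series in `z`. -/
noncomputable def blow (n : ℕ) (F : Ser 3) : PowerSeries ℂ :=
  ∑ i ∈ Finset.range (n + 1), PowerSeries.X ^ i * row i (n - i) F

theorem blow_add (n : ℕ) (F G : Ser 3) : blow n (F + G) = blow n F + blow n G := by
  simp only [blow, row_add, mul_add, Finset.sum_add_distrib]

theorem blow_zero_series (n : ℕ) : blow n 0 = 0 := by
  have h := blow_add n 0 0
  simpa using h

theorem blow_inZ_mul (n : ℕ) (u : PowerSeries ℂ) (F : Ser 3) :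
    blow n (inZ u * F) = u * blow n F := by
  simp only [blow, row_inZ_mul, Finset.mul_sum]
  exact Finset.sum_congr rfl fun i _ => by ring

theorem blow_succ_X_zero_mul (n : ℕ) (F : Ser 3) :
    blow (n + 1) (X 0 * F) = PowerSeries.X * blow n F := by
  rw [blow, Finset.sum_range_succ', row_zero_X_zero_mul, mul_zero, add_zero, blow, Finset.mul_sum]
  refine Finset.sum_congr rfl fun i _ => ?_
  rw [row_X_zero_mul, Nat.add_sub_add_right]
  ring

theorem blow_zero_X_zero_mul (F : Ser 3) : blow 0 (X 0 * F) = 0 := by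
  simp [blow, row_zero_X_zero_mul]

theorem blow_succ_X_one_mul (n : ℕ) (F : Ser 3) : blow (n + 1) (X 1 * F) = blow n F := by
  rw [blow, Finset.sum_range_succ, Nat.sub_self, row_zero_X_one_mul, mul_zero, add_zero, blow]
  refine Finset.sum_congr rfl fun i hi => ?_
  have hi' := Finset.mem_range.1 hi
  rw [show n + 1 - i = (n - i) + 1 by omega, row_X_one_mul]

theorem blow_zero_X_one_mul (F : Ser 3) : blow 0 (X 1 * F) = 0 := by
  simp [blow, row_zero_X_one_mul]

theorem coeff_blow (n N : ℕ) (F : Ser 3) : PowerSeries.coeff N (blow n F) =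
    ∑ i ∈ Finset.range (n + 1), if i ≤ N then coeff (expo i (n - i) (N - i)) F else 0 := by
  simp only [blow, map_sum, PowerSeries.coeff_X_pow_mul', coeff_row]

/-- The monomial `x^i y^{n-i}` becomes `z^i y^n`: without `z` in the series, the substitution is
injective and yields degree at most `n` in `z`. -/
theorem coeff_blow_of_scope {a : Ser 3} (ha : a ∈ formalScope 3 2) (n N : ℕ) :
    PowerSeries.coeff N (blow n a) = if N ≤ n then coeff (expo N (n - N) 0) a else 0 := by
  have h : ∀ i, i ≠ N → (if i ≤ N then coeff (expo i (n - i) (N - i)) a else 0) = 0 := by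
    intro i hi
    split_ifs with h
    · by_contra hne
      have := mem_scopeExponents_two.1 (ha _ hne)
      simp only [expo_two] at this
      omega
    · rfl
  rw [coeff_blow]
  split_ifs with hN
  · rw [Finset.sum_eq_single N (fun i _ hi => h i hi) fun hn =>
      absurd (Finset.mem_range.2 (Nat.lt_succ_of_le hN)) hn]
    simp
  · refine Finset.sum_eq_zero fun i hi => h i ?_
    have := Finset.mem_range.1 hi
    omega

theorem eq_zero_of_blow_eq_zero {a : Ser 3} (ha : a ∈ formalScope 3 2) (h : ∀ n, blow n a = 0) :
    a = 0 := by
  ext d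
  by_contra hne
  have h2 := mem_scopeExponents_two.1 (ha d hne)
  have h3 := coeff_blow_of_scope ha (d 0 + d 1) (d 0)
  rw [h, map_zero, if_pos (Nat.le_add_right _ _), Nat.add_sub_cancel_left, ← h2, expo_self] at h3
  exact hne h3.symm

end Echelon

/-! ### The echelon after substitution, and absence of relations. -/

namespace Gabrielov

open Echelon

theorem g_eq : g = X 0 * inZ (PowerSeries.exp ℂ - 1) := by
  rw [g, inZ_sub, inZ_one, inZ]

theorem gk_eq (k : ℕ) : gk k = X 0 ^ k * inZ (qSeries k) := rfl

theorem gk_one : gk 1 = g := by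
  rw [gk_eq, g_eq, pow_one, qSeries_one]

/-- The products `x c` and `y z c` have the same image under `x = yz`, and `c h` is their
difference. -/
theorem blow_mul_h (n : ℕ) (c : Ser 3) : blow n (c * h) = 0 := by
  have h1 : c * h + X 0 * c = X 1 * (inZ PowerSeries.X * c) := by
    rw [inZ_X, h]; ring
  have h2 := blow_add n (c * h) (X 0 * c)
  rw [h1] at h2
  rcases n with _ | n
  · simpa [blow_zero_X_zero_mul, blow_zero_X_one_mul] using h2.symm
  · rw [blow_succ_X_zero_mul, blow_succ_X_one_mul, blow_inZ_mul] at h2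
    simpa using h2.symm

/-- The part of degree `n` of `a f + b g + c h` modulo `h` has the form `A + z B (eᶻ - 1)` with
`deg A ≤ n` and `deg B < n`. -/
theorem exists_blow_eq {a b c : Ser 3} (ha : a ∈ formalScope 3 2) (hb : b ∈ formalScope 3 2)
    (n : ℕ) : ∃ B : PowerSeries ℂ, (∀ m, n = m + 1 → B = blow m b) ∧
      (∀ i, n < i → PowerSeries.coeff i (blow n a) = 0) ∧
      (∀ i, n ≤ i → PowerSeries.coeff i B = 0) ∧
      blow n (a * f + b * g + c * h) =
        blow n a + PowerSeries.X * B * (PowerSeries.exp ℂ - 1) := by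
  have h1 : ∀ i, n < i → PowerSeries.coeff i (blow n a) = 0 := fun i hi => by
    rw [coeff_blow_of_scope ha, if_neg (not_le.2 hi)]
  have h2 : b * g = X 0 * (inZ (PowerSeries.exp ℂ - 1) * b) := by
    rw [g_eq]; ring
  rw [blow_add, blow_add, blow_mul_h, h2, f, mul_one, add_zero]
  rcases n with _ | n
  -- The factor `x` of `g` shifts the degree, so `b` does not contribute in degree `0`.
  · exact ⟨0, fun m hm => absurd hm (by omega), h1, by simp, by simp [blow_zero_X_zero_mul]⟩
  · refine ⟨blow n b, fun m hm => by rw [Nat.succ_injective hm], h1, fun i hi => ?_, ?_⟩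
    · rw [coeff_blow_of_scope hb, if_neg (by omega)]
    · rw [blow_succ_X_zero_mul, blow_inZ_mul]
      ring

theorem h_ne_zero : h ≠ 0 := by
  intro h0
  have h1 := congrArg (coeff (Finsupp.single 0 1)) h0
  rw [h, map_sub, coeff_X_mul_eq, if_neg (by simp)] at h1
  simp [coeff_X] at h1

/-- The series `f, g, h` have no nontrivial linear relation respecting the scopes. -/
theorem relation_trivial {a b c : Ser 3} (ha : a ∈ formalScope 3 2) (hb : b ∈ formalScope 3 2)
    (h0 : a * f + b * g + c * h = 0) : a = 0 ∧ b = 0 ∧ c = 0 := by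
  have key : ∀ n, blow n a = 0 ∧ ∀ m, n = m + 1 → blow m b = 0 := by
    intro n
    obtain ⟨B, hB, h1, h2, h3⟩ := exists_blow_eq (c := c) ha hb n
    rw [h0, blow_zero_series] at h3
    have h4 := pade_exp_unique' h1 h2 fun i _ => by rw [← h3, map_zero]
    exact ⟨h4.1, fun m hm => by rw [← hB m hm, h4.2]⟩
  obtain rfl := eq_zero_of_blow_eq_zero ha fun n => (key n).1
  obtain rfl := eq_zero_of_blow_eq_zero hb fun n => (key (n + 1)).2 n rfl
  refine ⟨rfl, rfl, ?_⟩
  simpa [h_ne_zero] using h0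

/-! ### Initial exponents and regions of `f`, `h` and `g_k`. -/

theorem coeff_gk (k : ℕ) (d : Fin 3 →₀ ℕ) : coeff d (gk k) =
    if d 0 = k ∧ d 1 = 0 ∧ k ≤ d 2 then ((q (d 2) k : ℝ) : ℂ) else 0 := by
  have h0 : (d - (Finsupp.single 0 k : Fin 3 →₀ ℕ)) 0 = d 0 - k := by simp
  have h1 : (d - (Finsupp.single 0 k : Fin 3 →₀ ℕ)) 1 = d 1 := by simp
  have h2 : (d - (Finsupp.single 0 k : Fin 3 →₀ ℕ)) 2 = d 2 := by simp
  rw [gk_eq, coeff_X_pow_mul_eq, coeff_inZ, h0, h1, h2, qSeries, PowerSeries.coeff_mk]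
  split_ifs <;> first | rfl | omega

theorem lexOrder_gk {k : ℕ} (hk : 1 ≤ k) :
    (gk k).lexOrder = (toLex (expo k 0 k) : Lex (Fin 3 →₀ ℕ)) := by
  refine lexOrder_eq_of_coeff ?_ fun e he => ?_
  · rw [coeff_gk, if_pos (by simp)]
    simpa using (q_self_pos hk).ne'
  · rw [coeff_gk] at he
    rw [fin3_lex_le_iff]
    simp only [expo_zero, expo_one, expo_two]
    split_ifs at he with h1
    · omega
    · exact absurd rfl he

theorem initExp_gk {k : ℕ} (hk : 1 ≤ k) : initExp (gk k) = expo k 0 k :=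
  initExp_eq (lexOrder_gk hk)

theorem gk_ne_zero {k : ℕ} (hk : 1 ≤ k) : gk k ≠ 0 := by
  rw [ne_eq, ← lexOrder_eq_top_iff_eq_zero, lexOrder_gk hk]
  exact WithTop.coe_ne_top

theorem coeff_h (d : Fin 3 →₀ ℕ) : coeff d h =
    if d = expo 0 1 1 then 1 else if d = expo 1 0 0 then -1 else 0 := by
  have h1 : X 1 * X 2 = (monomial (expo 0 1 1) 1 : Ser 3) := by
    rw [X_def, X_def, monomial_mul_monomial, one_mul]
    congr 1
    simp [expo]
  have h2 : X 0 = (monomial (expo 1 0 0) 1 : Ser 3) := by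
    rw [X_def]
    simp [expo]
  have h3 : expo 1 0 0 ≠ expo 0 1 1 := fun h => by simpa using DFunLike.congr_fun h 0
  rw [h, h1, h2, map_sub, coeff_monomial, coeff_monomial]
  split_ifs with h4 h5 h5
  · exact absurd (h5.symm.trans h4) h3
  · simp
  · simp
  · simp

theorem lexOrder_h : h.lexOrder = (toLex (expo 0 1 1) : Lex (Fin 3 →₀ ℕ)) := by
  refine lexOrder_eq_of_coeff ?_ fun e he => ?_
  · rw [coeff_h, if_pos rfl]
    exact one_ne_zero
  · rw [coeff_h] at he
    split_ifs at he with h1 h2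
    · rw [h1]
    · rw [h2, fin3_lex_le_iff]
      simp
    · exact absurd rfl he

theorem initExp_h : initExp h = expo 0 1 1 := initExp_eq lexOrder_h

theorem f_ne_zero : f ≠ 0 := one_ne_zero

theorem initExp_f : initExp f = 0 := by
  refine initExp_eq (lexOrder_eq_of_coeff (by simp [f]) fun e he => ?_)
  rw [fin3_lex_le_iff]
  simp only [Finsupp.coe_zero, Pi.zero_apply]
  omega

theorem mem_region_f {d : Fin 3 →₀ ℕ} : d ∈ region f 2 ↔ d 2 = 0 := by
  simp [region, initExp_f, mem_scopeExponents_two]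

theorem mem_region_h {d : Fin 3 →₀ ℕ} : d ∈ region h 3 ↔ 1 ≤ d 1 ∧ 1 ≤ d 2 := by
  rw [region, initExp_h]
  constructor
  · rintro ⟨v, -, rfl⟩
    simp
  · intro hd
    refine ⟨d - expo 0 1 1, mem_scopeExponents_three _, fin3_ext ?_ ?_ ?_⟩ <;>
      simp only [Finsupp.add_apply, Finsupp.tsub_apply, expo_zero, expo_one, expo_two] <;> omega

theorem mem_region_gk {k : ℕ} (hk : 1 ≤ k) {d : Fin 3 →₀ ℕ} :
    d ∈ region (gk k) 2 ↔ k ≤ d 0 ∧ d 2 = k := by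
  rw [region, initExp_gk hk]
  constructor
  · rintro ⟨v, hv, rfl⟩
    simp [mem_scopeExponents_two.1 hv]
  · intro hd
    refine ⟨d - expo k 0 k, ?_, fin3_ext ?_ ?_ ?_⟩
    · rw [mem_scopeExponents_two]
      simp only [Finsupp.tsub_apply, expo_two]
      omega
    all_goals
      simp only [Finsupp.add_apply, Finsupp.tsub_apply, expo_zero, expo_one, expo_two]
      omega

end Gabrielov

/-! ### The recursion of the `g_k` as an echelon division. -/

namespace Gabrielov

open Echelon

/-- Multiply `qSeries_rec` by `x^{k+2}` and trade `x` for `yz` in the `qShift` term, at the cost of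
a multiple of `h`. -/
theorem gk_rec {k : ℕ} (hk : 1 ≤ k) : gk (k + 2) = -(X 1 * gk (k + 1)) +
    C ((q (k + 1) (k + 1) / q k k : ℝ) : ℂ) * X 0 ^ 2 * gk k +
      X 0 ^ (k + 1) * inZ (qShift (k + 1)) * h := by
  rw [gk_eq (k + 2), qSeries_rec hk, inZ_sub, inZ_mul, inZ_C, gk_eq (k + 1),
    qSeries_eq (Nat.le_add_left 1 k), inZ_mul, inZ_X, gk_eq k, h]
  ring

theorem gk_two : gk 2 = -(X 1 * gk 1) + X 0 ^ 2 * f + C (1 / 2) * X 0 * gk 1 +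
    X 0 * inZ (qShift 1) * h := by
  have h1 : inZ (qSeries 2) = 1 + C (1 / 2) * inZ (qSeries 1) - inZ (qShift 1) := by
    rw [qSeries_two, inZ_sub, inZ_add, inZ_mul, inZ_C, inZ_one]
  have h2 : inZ (qSeries 1) = X 2 * inZ (qShift 1) := by
    rw [qSeries_eq le_rfl, inZ_mul, inZ_X]
  rw [gk_eq 2, h1, gk_eq 1, h, f]
  linear_combination (X 0 * X 1) * h2

theorem sSeries_gk_h {k : ℕ} (hk : 1 ≤ k) : sSeries (gk k) h =
    -(X 1 * gk k) + monomial (expo k 0 (k - 1)) ((q k k : ℝ) : ℂ) * h := by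
  have h1 : (expo k 0 k ⊔ expo 0 1 1) - expo k 0 k = Finsupp.single 1 1 :=
    fin3_ext (by simp) (by simp) (by simp [hk])
  have h2 : (expo k 0 k ⊔ expo 0 1 1) - expo 0 1 1 = expo k 0 (k - 1) :=
    fin3_ext (by simp) (by simp) (by simp [hk])
  rw [sSeries, initExp_gk hk, initExp_h, h1, h2, coeff_h, if_pos rfl, coeff_gk,
    if_pos (by simp), expo_two, X_def]

/-- The quotient of `h` in the division of `S(g_k, h)`. -/
noncomputable def quotH (k : ℕ) : Ser 3 :=
  monomial (expo k 0 (k - 1)) ((q k k : ℝ) : ℂ) - X 0 ^ k * inZ (qShift k)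

theorem coeff_X_pow_mul_inZ (k : ℕ) (u : PowerSeries ℂ) (d : Fin 3 →₀ ℕ) :
    coeff d (X 0 ^ k * inZ u) = if d 0 = k ∧ d 1 = 0 then PowerSeries.coeff (d 2) u else 0 := by
  have h0 : (d - (Finsupp.single 0 k : Fin 3 →₀ ℕ)) 0 = d 0 - k := by simp
  have h1 : (d - (Finsupp.single 0 k : Fin 3 →₀ ℕ)) 1 = d 1 := by simp
  have h2 : (d - (Finsupp.single 0 k : Fin 3 →₀ ℕ)) 2 = d 2 := by simp
  rw [coeff_X_pow_mul_eq, coeff_inZ, h0, h1, h2]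
  split_ifs <;> first | rfl | omega

/-- The monomial from the S-series cancels the leading term in `z^{k-1}`. After multiplication by
the initial monomial `yz` of `h`, the power of `z` exceeds `k`, out of reach of `g_1, …, g_k`. -/
theorem coeff_quotH {k : ℕ} (hk : 1 ≤ k) {d : Fin 3 →₀ ℕ} (hd : coeff d (quotH k) ≠ 0) :
    d 0 = k ∧ d 1 = 0 ∧ k ≤ d 2 := by
  rw [quotH, map_sub, coeff_monomial, coeff_X_pow_mul_inZ, qShift, PowerSeries.coeff_mk] at hd
  split_ifs at hd with h1 h2 h3 h4 h5
  · exact absurd (by rw [h1, expo_two, Nat.sub_add_cancel hk, sub_self]) hd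
  · exact absurd (by rw [h1, expo_two, Nat.sub_add_cancel hk]) h3
  · exact absurd (by rw [h1]; simp) h2
  · refine ⟨h4.1, h4.2, ?_⟩
    by_contra hlt
    exact h1 (fin3_ext (by simp [h4.1]) (by simp [h4.2]) (by rw [expo_two]; omega))
  · simp at hd
  · simp at hd

theorem divisors_ne_zero (k : ℕ) : ∀ i, divisors k i ≠ 0
  | .inl 0 => f_ne_zero
  | .inl 1 => h_ne_zero
  | .inr j => gk_ne_zero (Nat.le_add_left 1 j)

theorem eq_of_mem_region_f {k : ℕ} {e : Fin 3 →₀ ℕ} (he : e 2 = 0) :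
    ∀ j, e ∈ region (divisors k j) (divisorScopes k j) → j = .inl 0
  | .inl 0, _ => rfl
  | .inl 1, hj => absurd (mem_region_h.1 hj).2 (by omega)
  | .inr j, hj => absurd ((mem_region_gk (Nat.le_add_left 1 j)).1 hj).2 (by omega)

theorem eq_of_mem_region_h {k : ℕ} {e : Fin 3 →₀ ℕ} (he : k < e 2) :
    ∀ j, e ∈ region (divisors k j) (divisorScopes k j) → j = .inl 1
  | .inl 0, hj => absurd (mem_region_f.1 hj) (by omega)
  | .inl 1, _ => rfl
  | .inr j, hj => absurd ((mem_region_gk (Nat.le_add_left 1 j)).1 hj).2 (by omega)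

theorem eq_of_mem_region_gk {k : ℕ} {e : Fin 3 →₀ ℕ} (i : Fin k) (he : e 1 = 0)
    (hi : e 2 = i + 1) : ∀ j, e ∈ region (divisors k j) (divisorScopes k j) → j = .inr i
  | .inl 0, hj => absurd (mem_region_f.1 hj) (by omega)
  | .inl 1, hj => absurd (mem_region_h.1 hj).1 (by omega)
  | .inr j, hj => by
    have := ((mem_region_gk (Nat.le_add_left 1 j)).1 hj).2
    rw [show j = i from Fin.ext (by omega)]

theorem gk_not_mem_region (k : ℕ) {d : Fin 3 →₀ ℕ} (hd : coeff d (gk (k + 1)) ≠ 0) :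
    d ∉ ⋃ i, region (divisors k i) (divisorScopes k i) := by
  have h1 : d 0 = k + 1 ∧ d 1 = 0 ∧ k + 1 ≤ d 2 := by
    rw [coeff_gk] at hd
    by_contra hn
    rw [if_neg hn] at hd
    exact hd rfl
  rw [Set.mem_iUnion]
  rintro ⟨i, hi⟩
  obtain rfl := eq_of_mem_region_h h1.2.2 i hi
  exact absurd (mem_region_h.1 hi).1 (by omega)

theorem C_mul_X_pow_eq (c : ℂ) (m : ℕ) :
    (C c * X 0 ^ m : Ser 3) = monomial (Finsupp.single 0 m) c := by
  rw [X_pow_eq, ← monomial_zero_eq_C_apply, monomial_mul_monomial, zero_add, mul_one]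

theorem single_mem_scope (m : ℕ) : (Finsupp.single 0 m : Fin 3 →₀ ℕ) ∈ scopeExponents 3 2 := by
  rw [mem_scopeExponents_two]
  simp

theorem isRemainder_one {P : Fin 2 ⊕ Fin 1 → Set (Fin 3 →₀ ℕ)}
    (hP : IsPartition (divisors 1) (divisorScopes 1) P) :
    IsRemainder (divisors 1) (divisorScopes 1) P (sSeries (gk 1) h) (gk 2) := by
  let a : Fin 2 ⊕ Fin 1 → Ser 3 := Sum.elim
    ![monomial (Finsupp.single 0 2) (-1), quotH 1] fun _ => monomial (Finsupp.single 0 1) (-(1 / 2))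
  have hs : ∀ i, a i ∈ formalScope 3 (divisorScopes 1 i)
    | .inl 0 => monomial_mem_formalScope (single_mem_scope 2) _
    | .inl 1 => mem_formalScope_self _
    | .inr _ => monomial_mem_formalScope (single_mem_scope 1) _
  refine isRemainder_of_eq (divisors_ne_zero 1) hP a hs ?_ (fun d => gk_not_mem_region 1) ?_
  · rw [Fintype.sum_sum_type, Fin.sum_univ_two, Fin.sum_univ_one]
    change _ = monomial (Finsupp.single 0 2) (-1) * f + quotH 1 * h +
      monomial (Finsupp.single 0 1) (-(1 / 2)) * gk 1 + gk 2
    rw [gk_two, sSeries_gk_h le_rfl, quotH, ← C_mul_X_pow_eq, ← C_mul_X_pow_eq, map_neg, map_neg,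
      map_one]
    ring
  · intro i d hd
    have hr : d + initExp (divisors 1 i) ∈ region (divisors 1 i) (divisorScopes 1 i) :=
      ⟨d, hs i d hd, add_comm _ _⟩
    refine hP.mem_of_unique hr ?_
    match i, hd with
    | .inl 0, hd =>
      obtain rfl := eq_of_coeff_monomial_ne_zero hd
      apply eq_of_mem_region_f
      change (Finsupp.single 0 2 + initExp f : Fin 3 →₀ ℕ) 2 = 0
      simp [initExp_f]
    | .inl 1, hd =>
      apply eq_of_mem_region_h
      change 1 < (d + initExp h) 2
      have := coeff_quotH le_rfl hd
      simp [initExp_h]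
      omega
    | .inr 0, hd =>
      obtain rfl := eq_of_coeff_monomial_ne_zero hd
      apply eq_of_mem_region_gk
      · change (Finsupp.single 0 1 + initExp (gk 1) : Fin 3 →₀ ℕ) 1 = 0
        simp [initExp_gk]
      · change (Finsupp.single 0 1 + initExp (gk 1) : Fin 3 →₀ ℕ) 2 = 0 + 1
        simp [initExp_gk]

theorem isRemainder_add_two (k : ℕ) {P : Fin 2 ⊕ Fin (k + 2) → Set (Fin 3 →₀ ℕ)}
    (hP : IsPartition (divisors (k + 2)) (divisorScopes (k + 2)) P) :
    IsRemainder (divisors (k + 2)) (divisorScopes (k + 2)) P (sSeries (gk (k + 2)) h)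
      (gk (k + 3)) := by
  set c : ℂ := ((q (k + 2) (k + 2) / q (k + 1) (k + 1) : ℝ) : ℂ) with hc
  -- Index `j` stands for `g_{j+1}`, so this is `g_{k+1}`, the only `g_j` with nonzero quotient.
  let i₀ : Fin (k + 2) := ⟨k, by omega⟩
  let a : Fin 2 ⊕ Fin (k + 2) → Ser 3 := Sum.elim ![0, quotH (k + 2)]
    fun j => if j = i₀ then monomial (Finsupp.single 0 2) (-c) else 0
  have hs : ∀ i, a i ∈ formalScope 3 (divisorScopes (k + 2) i)
    | .inl 0 => zero_mem _
    | .inl 1 => mem_formalScope_self _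
    | .inr j => by
      change (if j = i₀ then _ else _) ∈ formalScope 3 2
      split_ifs
      · exact monomial_mem_formalScope (single_mem_scope 2) _
      · exact zero_mem _
  refine isRemainder_of_eq (divisors_ne_zero _) hP a hs ?_ (fun d => gk_not_mem_region _) ?_
  · rw [Fintype.sum_sum_type, Fin.sum_univ_two]
    change _ = 0 * f + quotH (k + 2) * h + ∑ j : Fin (k + 2),
      (if j = i₀ then monomial (Finsupp.single 0 2) (-c) else 0) * gk (j + 1) + gk (k + 3)
    rw [Finset.sum_eq_single i₀ (fun j _ hj => by rw [if_neg hj, zero_mul])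
      (fun hn => absurd (Finset.mem_univ _) hn), if_pos rfl, gk_rec (Nat.le_add_left 1 k),
      sSeries_gk_h (by omega), quotH, ← C_mul_X_pow_eq, map_neg, ← hc]
    ring
  · intro i d hd
    have hr : d + initExp (divisors (k + 2) i) ∈
        region (divisors (k + 2) i) (divisorScopes (k + 2) i) :=
      ⟨d, hs i d hd, add_comm _ _⟩
    refine hP.mem_of_unique hr ?_
    match i, hd with
    | .inl 0, hd => exact absurd rfl hd
    | .inl 1, hd =>
      apply eq_of_mem_region_h
      change k + 2 < (d + initExp h) 2
      have := coeff_quotH (by omega) hd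
      simp [initExp_h]
      omega
    | .inr j, hd =>
      change coeff d (if j = i₀ then _ else _) ≠ 0 at hd
      split_ifs at hd with hj
      · subst hj
        obtain rfl := eq_of_coeff_monomial_ne_zero hd
        apply eq_of_mem_region_gk
        · change (Finsupp.single 0 2 + initExp (gk (k + 1)) : Fin 3 →₀ ℕ) 1 = 0
          simp [initExp_gk]
        · change (Finsupp.single 0 2 + initExp (gk (k + 1)) : Fin 3 →₀ ℕ) 2 = k + 1
          simp [initExp_gk]
      · simp at hd

/-- `g_{k+1}` is the remainder of the division of `S(g_k, h)`, for each partition. -/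
theorem isRemainder_iff {k : ℕ} (hk : 1 ≤ k) {P : Fin 2 ⊕ Fin k → Set (Fin 3 →₀ ℕ)}
    (hP : IsPartition (divisors k) (divisorScopes k) P) (b : Ser 3) :
    IsRemainder (divisors k) (divisorScopes k) P (sSeries (gk k) h) b ↔ b = gk (k + 1) := by
  have hex : IsRemainder (divisors k) (divisorScopes k) P (sSeries (gk k) h) (gk (k + 1)) := by
    match k, hk with
    | 1, _ => exact isRemainder_one hP
    | k + 2, _ => exact isRemainder_add_two k hP
  refine ⟨fun hb => hb.unique (divisors_ne_zero k) hP hex, ?_⟩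
  rintro rfl
  exact hex

end Gabrielov

/-! ### Convergence and coefficient bounds. -/

namespace Echelon

theorem summable_half_pow_degree : Summable fun d : Fin 3 →₀ ℕ => (1 / 2 : ℝ) ^ d.degree := by
  have h1 : Summable fun n : ℕ => (1 / 2 : ℝ) ^ n := summable_geometric_two
  have h0 : 0 ≤ fun n : ℕ => (1 / 2 : ℝ) ^ n := fun n => by positivity
  have h2 := h1.mul_of_nonneg h1 h0 h0
  have h3 := h1.mul_of_nonneg h2 h0 fun p => by positivity
  have hi : Function.Injective fun d : Fin 3 →₀ ℕ => (d 0, d 1, d 2) := by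
    intro d e hde
    simp only [Prod.mk.injEq] at hde
    exact fin3_ext hde.1 hde.2.1 hde.2.2
  refine (h3.comp_injective hi).congr fun d => ?_
  rw [Finsupp.degree_eq_sum, Fin.sum_univ_three, pow_add, pow_add, mul_assoc]
  rfl

theorem isConvergent_of_bounded {F : Ser 3} (M : ℝ) (hF : ∀ d, ‖coeff d F‖ ≤ M) :
    IsConvergent F :=
  ⟨1 / 2, by norm_num, Summable.of_nonneg_of_le (fun d => by positivity)
    (fun d => mul_le_mul_of_nonneg_right (hF d) (by positivity))
    (summable_half_pow_degree.mul_left M)⟩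

/-- The radius is shrunk to at most `1` so that estimates remain usable when only an upper bound for
the degree is known. -/
theorem IsConvergent.exists_bound {n : ℕ} {F : Ser n} (hF : IsConvergent F) :
    ∃ r : ℝ, 0 < r ∧ r ≤ 1 ∧ ∃ M : ℝ, 0 < M ∧ ∀ d, ‖coeff d F‖ * r ^ d.degree ≤ M := by
  obtain ⟨r, hr, hF⟩ := hF
  refine ⟨min r 1, lt_min hr one_pos, min_le_right _ _,
    (∑' d, ‖coeff d F‖ * r ^ d.degree) + 1, ?_, fun d => ?_⟩
  · have : 0 ≤ ∑' d, ‖coeff d F‖ * r ^ d.degree := tsum_nonneg fun d => by positivity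
    linarith
  · have h1 := hF.le_tsum d fun e _ => by positivity
    have h2 : min r 1 ^ d.degree ≤ r ^ d.degree :=
      pow_le_pow_left₀ (lt_min hr one_pos).le (min_le_left _ _) _
    have h3 := mul_le_mul_of_nonneg_left h2 (norm_nonneg (coeff d F))
    linarith

end Echelon

/-! ### Convergent cofactors and the standard basis. -/

namespace Gabrielov

open Echelon

theorem inZ_mem_convScope (k : ℕ) (hk : 1 ≤ k) : inZ (qShift k) ∈ convScope 3 3 := by
  refine ⟨mem_formalScope_self _, isConvergent_of_bounded (q k k) fun d => ?_⟩
  have h0 := (q_self_pos hk).le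
  rw [coeff_inZ, qShift, PowerSeries.coeff_mk]
  split_ifs with h1 h2
  · rw [Complex.norm_real, Real.norm_eq_abs, abs_of_pos (q_pos hk h2)]
    exact q_le hk h2
  · simpa
  · simpa

/-- The coefficient of `f` in the representation of `g_k` by `f, g, h`. -/
noncomputable def cofA : ℕ → Ser 3
  | 0 => 0
  | 1 => 0
  | 2 => X 0 ^ 2
  | k + 3 => -(X 1 * cofA (k + 2)) +
      C ((q (k + 2) (k + 2) / q (k + 1) (k + 1) : ℝ) : ℂ) * (X 0 ^ 2 * cofA (k + 1))

/-- The coefficient of `g` in the representation of `g_k` by `f, g, h`. -/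
noncomputable def cofB : ℕ → Ser 3
  | 0 => 0
  | 1 => 1
  | 2 => -X 1 + C (1 / 2) * X 0
  | k + 3 => -(X 1 * cofB (k + 2)) +
      C ((q (k + 2) (k + 2) / q (k + 1) (k + 1) : ℝ) : ℂ) * (X 0 ^ 2 * cofB (k + 1))

/-- The coefficient of `h` in the representation of `g_k` by `f, g, h`. -/
noncomputable def cofC : ℕ → Ser 3
  | 0 => 0
  | 1 => 0
  | 2 => X 0 * inZ (qShift 1)
  | k + 3 => -(X 1 * cofC (k + 2)) +
      C ((q (k + 2) (k + 2) / q (k + 1) (k + 1) : ℝ) : ℂ) * (X 0 ^ 2 * cofC (k + 1)) +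
        X 0 ^ (k + 2) * inZ (qShift (k + 2))

theorem gk_eq_cof : ∀ k, gk (k + 1) = cofA (k + 1) * f + cofB (k + 1) * g + cofC (k + 1) * h
  | 0 => by simp [gk_one, cofA, cofB, cofC]
  | 1 => by
    rw [show 1 + 1 = 2 from rfl, gk_two, gk_one, cofA, cofB, cofC]
    ring
  | k + 2 => by
    rw [show k + 2 + 1 = k + 1 + 2 from rfl, gk_rec (Nat.le_add_left 1 k), gk_eq_cof (k + 1),
      gk_eq_cof k, show k + 1 + 2 = k + 3 from rfl, cofA, cofB, cofC]
    ring

theorem C_mul_mem_convScope (c : ℂ) {s : ℕ} {F : Ser 3} (hF : F ∈ convScope 3 s) :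
    C c * F ∈ convScope 3 s := by
  rw [← smul_eq_C_mul]
  exact Submodule.smul_mem _ c hF

theorem one_mem_convScope (s : ℕ) : (1 : Ser 3) ∈ convScope 3 s :=
  monomial_mem_convScope (fun _ _ => rfl) 1

theorem X_pow_mem_convScope {s : ℕ} (i : Fin 3) (hi : i.val < s) (m : ℕ) :
    (X i ^ m : Ser 3) ∈ convScope 3 s := by
  induction m with
  | zero => rw [pow_zero]; exact one_mem_convScope s
  | succ m ih => rw [pow_succ]; exact convScope_mul ih (X_mem_convScope i hi)

theorem step_mem_convScope {s : ℕ} (hs : 2 ≤ s) (c : ℂ) {F G : Ser 3} (hF : F ∈ convScope 3 s)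
    (hG : G ∈ convScope 3 s) : -(X 1 * F) + C c * (X 0 ^ 2 * G) ∈ convScope 3 s :=
  add_mem (neg_mem (convScope_mul (X_mem_convScope 1 hs) hF))
    (C_mul_mem_convScope _ (convScope_mul (X_pow_mem_convScope 0 (by simp; omega) 2) hG))

theorem cofA_mem : ∀ k, cofA k ∈ convScope 3 2
  | 0 => zero_mem _
  | 1 => zero_mem _
  | 2 => X_pow_mem_convScope 0 (by simp) 2
  | k + 3 => step_mem_convScope le_rfl _ (cofA_mem (k + 2)) (cofA_mem (k + 1))

theorem cofB_mem : ∀ k, cofB k ∈ convScope 3 2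
  | 0 => zero_mem _
  | 1 => one_mem_convScope 2
  | 2 => add_mem (neg_mem (X_mem_convScope 1 (by simp)))
      (C_mul_mem_convScope _ (X_mem_convScope 0 (by simp)))
  | k + 3 => step_mem_convScope le_rfl _ (cofB_mem (k + 2)) (cofB_mem (k + 1))

theorem cofC_mem : ∀ k, cofC k ∈ convScope 3 3
  | 0 => zero_mem _
  | 1 => zero_mem _
  | 2 => convScope_mul (X_mem_convScope 0 (by simp)) (inZ_mem_convScope 1 le_rfl)
  | k + 3 => add_mem (step_mem_convScope (by omega) _ (cofC_mem (k + 2)) (cofC_mem (k + 1)))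
      (convScope_mul (X_pow_mem_convScope 0 (by simp) _) (inZ_mem_convScope _ (by omega)))

theorem mem_echelon_gens {R : ℕ → Submodule ℂ (Ser 3)} {F : Ser 3} :
    F ∈ echelon R gens scopes ↔
      ∃ a ∈ R 2, ∃ b ∈ R 2, ∃ c ∈ R 3, F = a * f + b * g + c * h := by
  have h1 : echelon R gens scopes = summand (R 2) f ⊔ summand (R 2) g ⊔ summand (R 3) h := by
    refine le_antisymm (iSup_le fun i => ?_) (sup_le (sup_le ?_ ?_) ?_)
    · match i with
      | 0 => exact le_sup_left.trans le_sup_left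
      | 1 => exact le_sup_right.trans le_sup_left
      | 2 => exact le_sup_right
    · exact le_iSup (fun i => summand (R (scopes i)) (gens i)) 0
    · exact le_iSup (fun i => summand (R (scopes i)) (gens i)) 1
    · exact le_iSup (fun i => summand (R (scopes i)) (gens i)) 2
  rw [h1]
  simp only [Submodule.mem_sup, mem_summand]
  constructor
  · rintro ⟨_, ⟨_, ⟨a, ha, rfl⟩, _, ⟨b, hb, rfl⟩, rfl⟩, _, ⟨c, hc, rfl⟩, rfl⟩
    exact ⟨a, ha, b, hb, c, hc, rfl⟩
  · rintro ⟨a, ha, b, hb, c, hc, rfl⟩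
    exact ⟨_, ⟨_, ⟨a, ha, rfl⟩, _, ⟨b, hb, rfl⟩, rfl⟩, _, ⟨c, hc, rfl⟩, rfl⟩

theorem iSupIndep_formal : iSupIndep fun i => summand (formalScope 3 (scopes i)) (gens i) := by
  classical
  rw [iSupIndep_iff_finsetSum_eq_zero_imp_eq_zero]
  intro s v hv h0
  -- Extension by zero turns a relation among some summands into one among all three.
  have hw : ∀ i, (if i ∈ s then v i else 0) ∈ summand (formalScope 3 (scopes i)) (gens i) := by
    intro i
    split_ifs with hi
    · exact hv i hi
    · exact zero_mem _
  have hsum : ∑ i, (if i ∈ s then v i else 0) = 0 := by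
    rw [Finset.sum_ite_mem, Finset.univ_inter, h0]
  choose a ha hav using fun i => mem_summand.1 (hw i)
  have h1 : a 0 * f + a 1 * g + a 2 * h = 0 := by
    rw [← hsum, Fin.sum_univ_three, ← hav 0, ← hav 1, ← hav 2]
    rfl
  obtain ⟨e0, e1, e2⟩ := relation_trivial (ha 0) (ha 1) h1
  intro i hi
  have h2 := hav i
  rw [if_pos hi] at h2
  rw [← h2]
  fin_cases i
  · exact (congrArg (· * gens 0) e0).trans (zero_mul _)
  · exact (congrArg (· * gens 1) e1).trans (zero_mul _)
  · exact (congrArg (· * gens 2) e2).trans (zero_mul _)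

theorem iSupIndep_conv : iSupIndep fun i => summand (convScope 3 (scopes i)) (gens i) :=
  iSupIndep_formal.mono fun _ => Submodule.map_mono inf_le_left

/-- The initial exponents of the elements of the completed echelon. -/
theorem initExp_mem_region {F : Ser 3} (hF : F ∈ Ihat) (h0 : F ≠ 0) :
    initExp F ∈ ⋃ j, region (basis j) (basisScopes j) := by
  obtain ⟨a, ha, b, hb, c, -, habc⟩ := mem_echelon_gens.1 hF
  set d := initExp F with hd
  rw [Set.mem_iUnion]
  by_cases h2 : d 2 = 0
  · exact ⟨.inl 0, mem_region_f.2 h2⟩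
  by_cases h1 : d 1 = 0
  swap
  · exact ⟨.inl 1, mem_region_h.2 ⟨by omega, by omega⟩⟩
  by_cases h3 : d 2 ≤ d 0
  · refine ⟨.inr (d 2 - 1), ?_⟩
    change d ∈ region (gk (d 2 - 1 + 1)) 2
    rw [mem_region_gk (by omega)]
    omega
  -- What remains is an initial monomial `x^i z^k` with `k > i`, to be excluded by the Padé argument
  -- in degree `i`.
  exfalso
  have hlow : ∀ e, toLex e < toLex d → coeff e F = 0 := fun e he =>
    coeff_eq_zero_of_lt_lexOrder (by rw [lexOrder_eq_initExp h0]; exact WithTop.coe_lt_coe.2 he)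
  -- All other monomials of this degree in `x, y` have a smaller power of `x`, hence precede the
  -- initial monomial and are absent.
  have hco : ∀ N, PowerSeries.coeff N (blow (d 0) F) =
      if d 0 ≤ N then coeff (expo (d 0) 0 (N - d 0)) F else 0 := by
    intro N
    rw [coeff_blow, Finset.sum_eq_single (d 0), Nat.sub_self]
    · intro i hi hne
      have := Finset.mem_range.1 hi
      rw [hlow, ite_self]
      rw [fin3_lex_lt_iff, expo_zero]
      omega
    · intro hn
      simp at hn
  obtain ⟨B, -, hA, hB, hAB⟩ := exists_blow_eq (c := c) ha hb (d 0)
  rw [← habc] at hAB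
  -- For `i < 2 d₀ + 1` the power of `z` is at most `d₀ < d₂`, below the initial monomial.
  have hz := pade_exp_unique' hA hB fun i hi => by
    rw [← hAB, hco]
    split_ifs with h4
    · apply hlow
      rw [fin3_lex_lt_iff, expo_zero, expo_one, expo_two]
      omega
    · rfl
  have h5 := hco (d 0 + d 2)
  rw [hAB, hz.1, hz.2, mul_zero, zero_mul, add_zero, map_zero, if_pos (Nat.le_add_right _ _),
    Nat.add_sub_cancel_left, ← h1, expo_self] at h5
  exact coeff_initExp_ne_zero h0 h5.symm

/-- Both cases at once: the bound on initial exponents needs only membership in `Ihat`, while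
attaining them needs only monomials and the convergent cofactors. -/
theorem isStandardBasis_basis {R : ℕ → Submodule ℂ (Ser 3)} (h1 : ∀ s, R s ≤ formalScope 3 s)
    (h2 : ∀ s, convScope 3 s ≤ R s)
    (hm : ∀ s, ∀ F ∈ R s, ∀ G ∈ R s, F * G ∈ R s) (h23 : R 2 ≤ R 3) :
    IsStandardBasis R (echelon R gens scopes) basis basisScopes := by
  have hne : ∀ j, basis j ≠ 0
    | .inl 0 => f_ne_zero
    | .inl 1 => h_ne_zero
    | .inr j => gk_ne_zero (Nat.le_add_left 1 j)
  have hle : ∀ j, summand (R (basisScopes j)) (basis j) ≤ echelon R gens scopes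
    | .inl 0 => le_iSup (fun i => summand (R (scopes i)) (gens i)) 0
    | .inl 1 => le_iSup (fun i => summand (R (scopes i)) (gens i)) 2
    | .inr j => by
      intro F hF
      obtain ⟨a, ha, rfl⟩ := mem_summand.1 hF
      have ha : a ∈ R 2 := ha
      refine mem_echelon_gens.2 ⟨a * cofA (j + 1), hm _ _ ha _ (h2 _ (cofA_mem _)),
        a * cofB (j + 1), hm _ _ ha _ (h2 _ (cofB_mem _)),
        a * cofC (j + 1), hm _ _ (h23 ha) _ (h2 _ (cofC_mem _)), ?_⟩
      change a * gk (j + 1) = _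
      rw [gk_eq_cof]
      ring
  refine ⟨hne, fun j => hle j (mem_summand.2 ⟨1, h2 _ (one_mem_convScope _), one_mul _⟩), hle,
    Set.Subset.antisymm ?_ (Set.iUnion_subset fun j => ?_)⟩
  · rintro _ ⟨F, hF, h0, rfl⟩
    refine initExp_mem_region ?_ h0
    obtain ⟨a, ha, b, hb, c, hc, rfl⟩ := mem_echelon_gens.1 hF
    exact mem_echelon_gens.2 ⟨a, h1 _ ha, b, h1 _ hb, c, h1 _ hc, rfl⟩
  · exact region_subset_initialExponents (hne j) (hle j)
      fun d hd => h2 _ (monomial_mem_convScope hd 1)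

theorem isStandardBasis_conv : IsStandardBasis (convScope 3) I basis basisScopes :=
  isStandardBasis_basis (fun _ => inf_le_left) (fun _ => le_rfl)
    (fun _ _ hF _ hG => convScope_mul hF hG) (convScope_mono (by omega))

theorem isStandardBasis_formal : IsStandardBasis (formalScope 3) Ihat basis basisScopes :=
  isStandardBasis_basis (fun _ => le_rfl) (fun _ => inf_le_left)
    (fun _ _ hF _ hG => formalScope_mul hF hG) (formalScope_mono (by omega))

/-! ### Coefficients `±1` of the cofactors. -/

/-- Along the tracked monomials the `x^2` term of the recursion is silent, so each step merely
raises the power of `y` and changes the sign. -/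
theorem coeff_step {c : ℂ} {F G : Ser 3} {i k : ℕ}
    (hG : 2 ≤ i → coeff (expo (i - 2) (k + 1) 0) G = 0) :
    coeff (expo i (k + 1) 0) (-(X 1 * F) + C c * (X 0 ^ 2 * G)) = -coeff (expo i k 0) F := by
  rw [map_add, map_neg, coeff_X_mul_eq, if_pos (by simp), coeff_C_mul, coeff_X_pow_mul_eq,
    show expo i (k + 1) 0 - Finsupp.single 1 1 = expo i k 0 from
      fin3_ext (by simp) (by simp) (by simp),
    show expo i (k + 1) 0 - Finsupp.single 0 2 = expo (i - 2) (k + 1) 0 from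
      fin3_ext (by simp) (by simp) (by simp), expo_zero]
  split_ifs with hi
  · rw [hG hi, mul_zero, add_zero]
  · rw [mul_zero, add_zero]

theorem coeff_cofB : ∀ k, coeff (expo 0 k 0) (cofB (k + 1)) = (-1) ^ k
  | 0 => by
    have : expo 0 0 0 = 0 := fin3_ext (by simp) (by simp) (by simp)
    simp [cofB, this]
  | 1 => by
    have h1 : expo 0 1 0 = Finsupp.single 1 1 := by simp [expo]
    have h2 : (Finsupp.single 1 1 : Fin 3 →₀ ℕ) ≠ Finsupp.single 0 1 := fun h => by
      simpa using DFunLike.congr_fun h 0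
    rw [show 1 + 1 = 2 from rfl, cofB, map_add, map_neg, coeff_C_mul, h1, coeff_X, coeff_X,
      if_pos rfl, if_neg h2]
    simp
  | k + 2 => by
    rw [show k + 2 + 1 = k + 3 from rfl, cofB, coeff_step (by simp),
      show k + 2 = k + 1 + 1 from rfl, coeff_cofB (k + 1), pow_succ _ (k + 1)]
    ring

/-- Needed to silence the `x^2` term when following `x^2 y^k` in `cofA`. -/
theorem coeff_cofA_zero : ∀ k j, coeff (expo 0 j 0) (cofA k) = 0
  | 0, _ => map_zero _
  | 1, _ => map_zero _
  | 2, j => by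
    rw [cofA, ← mul_one (X 0 ^ 2), coeff_X_pow_mul_eq, if_neg (by simp)]
  | k + 3, 0 => by
    rw [cofA, map_add, map_neg, coeff_X_mul_eq, if_neg (by simp), coeff_C_mul,
      coeff_X_pow_mul_eq, if_neg (by simp)]
    simp
  | k + 3, j + 1 => by
    rw [cofA, coeff_step (by simp), coeff_cofA_zero (k + 2) j, neg_zero]

theorem coeff_cofA : ∀ k, coeff (expo 2 k 0) (cofA (k + 2)) = (-1) ^ k
  | 0 => by
    have : expo 2 0 0 = Finsupp.single 0 2 := by simp [expo]
    rw [cofA, this, coeff_X_pow, if_pos rfl, pow_zero]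
  | k + 1 => by
    have h0 := coeff_cofA_zero (k + 1) (k + 1)
    rw [show k + 1 + 2 = k + 3 from rfl, cofA,
      coeff_step (fun _ => by rw [Nat.sub_self]; exact h0), coeff_cofA k, pow_succ]
    ring

theorem coeff_cofC : ∀ k, coeff (expo 1 k 0) (cofC (k + 2)) = (-1) ^ k
  | 0 => by
    rw [cofC, ← pow_one (X 0), coeff_X_pow_mul_inZ, if_pos (by simp), qShift,
      PowerSeries.coeff_mk, expo_two, if_pos le_rfl, q_one le_rfl]
    simp
  | k + 1 => by
    rw [show k + 1 + 2 = k + 3 from rfl, cofC, map_add, coeff_step (by simp), coeff_cofC k,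
      coeff_X_pow_mul_inZ, if_neg (by simp), pow_succ]
    ring

/-! ### The convergent sum with divergent cofactors. -/

/-- The series whose part of degree `n` in `x, y` agrees with that of `u n`. -/
noncomputable def glue (u : ℕ → Ser 3) : Ser 3 := fun d => coeff d (u (d 0 + d 1))

theorem coeff_glue (u : ℕ → Ser 3) (d : Fin 3 →₀ ℕ) :
    coeff d (glue u) = coeff d (u (d 0 + d 1)) := rfl

theorem glue_add (u v : ℕ → Ser 3) : glue u + glue v = glue fun n => u n + v n := by
  ext d
  rw [map_add, coeff_glue, coeff_glue, coeff_glue, map_add]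

/-- Homogeneity of `G` alone suffices: it shifts the degree in `x, y` by `s`, so the pieces `u n`
need not be homogeneous. -/
theorem glue_mul (u : ℕ → Ser 3) {G : Ser 3} {s : ℕ} (hG : ∀ d, coeff d G ≠ 0 → d 0 + d 1 = s) :
    glue u * G = glue fun n => if s ≤ n then u (n - s) * G else 0 := by
  classical
  ext d
  rw [coeff_glue, coeff_mul]
  have key : ∀ p ∈ Finset.HasAntidiagonal.antidiagonal d, coeff p.2 G ≠ 0 →
      d 0 + d 1 = p.1 0 + p.1 1 + s := by
    intro p hp hne
    have h1 := Finset.HasAntidiagonal.mem_antidiagonal.1 hp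
    rw [← h1, ← hG _ hne]
    simp only [Finsupp.add_apply]
    omega
  split_ifs with hs
  · rw [coeff_mul]
    refine Finset.sum_congr rfl fun p hp => ?_
    by_cases h0 : coeff p.2 G = 0
    · rw [h0, mul_zero, mul_zero]
    · rw [coeff_glue, key p hp h0, Nat.add_sub_cancel]
  · rw [map_zero]
    refine Finset.sum_eq_zero fun p hp => ?_
    by_cases h0 : coeff p.2 G = 0
    · rw [h0, mul_zero]
    · exact absurd (key p hp h0) (by omega)

theorem glue_mem_formalScope {u : ℕ → Ser 3} {s : ℕ} (hu : ∀ n, u n ∈ formalScope 3 s) :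
    glue u ∈ formalScope 3 s := fun d hd => hu _ d hd

theorem weight_gk {k : ℕ} {d : Fin 3 →₀ ℕ} (hd : coeff d (gk k) ≠ 0) : d 0 + d 1 = k := by
  rw [coeff_gk] at hd
  split_ifs at hd with h1
  · omega
  · exact absurd rfl hd

theorem weight_g {d : Fin 3 →₀ ℕ} (hd : coeff d g ≠ 0) : d 0 + d 1 = 1 := by
  rw [← gk_one] at hd
  exact weight_gk hd

theorem weight_h {d : Fin 3 →₀ ℕ} (hd : coeff d h ≠ 0) : d 0 + d 1 = 1 := by
  rw [coeff_h] at hd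
  split_ifs at hd with h1 h2
  · simp [h1]
  · simp [h2]
  · exact absurd rfl hd

theorem weight_f {d : Fin 3 →₀ ℕ} (hd : coeff d f ≠ 0) : d 0 + d 1 = 0 := by
  rw [f, coeff_one] at hd
  split_ifs at hd with h1
  · simp [h1]
  · exact absurd rfl hd

/-- The weight `1 / q_{n,n}` for `n ≥ m`, and `0` otherwise. -/
noncomputable def qInv (m n : ℕ) : ℂ := if m ≤ n then (((q n n)⁻¹ : ℝ) : ℂ) else 0

/-- The sum of the series `g_k / q_{k,k}` for `k ≥ m`. -/
noncomputable def gkSum (m : ℕ) : Ser 3 := glue fun n => qInv m n • gk n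

theorem coeff_gkSum (m : ℕ) (d : Fin 3 →₀ ℕ) :
    coeff d (gkSum m) = qInv m (d 0 + d 1) * coeff d (gk (d 0 + d 1)) := by
  rw [gkSum, coeff_glue, map_smul, smul_eq_mul]

theorem isFormalSum_gkSum (m : ℕ) :
    IsFormalSum (fun j => (((q (m + j) (m + j))⁻¹ : ℝ) : ℂ) • gk (m + j)) (gkSum m) := by
  intro d
  have h1 : ∀ j, j ≠ d 0 + d 1 - m →
      coeff d ((((q (m + j) (m + j))⁻¹ : ℝ) : ℂ) • gk (m + j)) = 0 := by
    intro j hj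
    by_contra hne
    rw [map_smul, smul_eq_mul] at hne
    have := weight_gk (right_ne_zero_of_mul hne)
    omega
  refine ⟨(Set.finite_singleton (d 0 + d 1 - m)).subset fun j hj => ?_, ?_⟩
  · by_contra hne
    exact hj (h1 j hne)
  · rw [finsum_eq_single _ _ h1, coeff_gkSum, map_smul, smul_eq_mul, qInv]
    split_ifs with hm
    · rw [Nat.add_sub_cancel' hm]
    -- Truncated subtraction selects `g_m`, which has no monomial of degree below `m` in `x, y`.
    · have h2 : coeff d (gk (m + (d 0 + d 1 - m))) = 0 := by
        by_contra hne
        have := weight_gk hne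
        omega
      rw [h2, zero_mul, mul_zero]

theorem gkSum_scope {m : ℕ} {d : Fin 3 →₀ ℕ} (hd : coeff d (gkSum m) ≠ 0) : d 1 = 0 := by
  rw [coeff_gkSum] at hd
  have h1 := right_ne_zero_of_mul hd
  rw [coeff_gk] at h1
  split_ifs at h1 with h2
  · exact h2.2.1
  · exact absurd rfl h1

/-- The normalisation by `q_{k,k}` makes all coefficients at most `1` in modulus, by `q_le`. -/
theorem isConvergent_gkSum {m : ℕ} (hm : 1 ≤ m) : IsConvergent (gkSum m) := by
  refine isConvergent_of_bounded 1 fun d => ?_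
  rw [coeff_gkSum, coeff_gk, qInv]
  split_ifs with h1 h2
  · have h3 := q_self_pos (hm.trans h1)
    rw [← Complex.ofReal_mul, Complex.norm_real, Real.norm_eq_abs,
      abs_of_nonneg (mul_nonneg (inv_nonneg.2 h3.le) (q_pos (hm.trans h1) h2.2.2).le),
      inv_mul_le_iff₀ h3, mul_one]
    exact q_le (hm.trans h1) h2.2.2
  · simp
  · simp
  · simp

/-- Since `g` and `h` have degree `1` in `x, y`, the degree-`n` parts of their cofactors come from
`g_{n+1}`, those for `f` from `g_n`. -/
theorem gkSum_eq {m : ℕ} (hm : 1 ≤ m) : gkSum m =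
    (glue fun n => qInv m n • cofA n) * f +
      (glue fun n => qInv m (n + 1) • cofB (n + 1)) * g +
      (glue fun n => qInv m (n + 1) • cofC (n + 1)) * h := by
  rw [glue_mul _ fun _ => weight_f, glue_mul _ fun _ => weight_g, glue_mul _ fun _ => weight_h,
    glue_add, glue_add, gkSum]
  congr 1
  funext n
  rcases n with _ | n
  · have h0 : qInv m 0 = 0 := if_neg (by omega)
    simp [h0]
  · rw [if_pos (Nat.zero_le _), if_pos (by omega), if_pos (by omega), Nat.sub_zero,
      Nat.add_sub_cancel, gk_eq_cof]
    simp only [smul_add, smul_mul_assoc]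

open Filter Topology in
/-- A series with coefficients of modulus `1 / q_{n,n}` in degrees at most `n` diverges. -/
theorem not_isConvergent_of_coeff {F : Ser 3} (N : ℕ)
    (hF : ∀ n, N ≤ n → ∃ d : Fin 3 →₀ ℕ, d.degree ≤ n ∧ ‖coeff d F‖ = (q n n)⁻¹) :
    ¬ IsConvergent F := by
  intro hc
  obtain ⟨r, hr, hr1, M, hM, hb⟩ := hc.exists_bound
  -- Convergence would give `r^n / q_{n,n} ≤ M`, that is, `r^{-n} q_{n,n} ≥ 1/M` for all large `n`.
  have ht := tendsto_pow_mul_q r⁻¹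
  have h1 := (ht.eventually (gt_mem_nhds (inv_pos.2 hM))).and
    (eventually_ge_atTop (max N 1))
  obtain ⟨n, hn, hnN⟩ := h1.exists
  obtain ⟨d, hd, hdF⟩ := hF n ((le_max_left _ _).trans hnN)
  have hq := q_self_pos ((le_max_right _ _).trans hnN)
  have h2 : (q n n)⁻¹ * r ^ n ≤ M := by
    refine le_trans ?_ (hb d)
    rw [hdF]
    exact mul_le_mul_of_nonneg_left (pow_le_pow_of_le_one hr.le hr1 hd) (inv_pos.2 hq).le
  have h3 := inv_anti₀ (mul_pos (inv_pos.2 hq) (pow_pos hr n)) h2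
  rw [mul_inv, inv_inv, mul_comm, ← inv_pow] at h3
  exact absurd hn (not_lt.2 h3)

theorem norm_qInv_mul {m n j : ℕ} (hm : 1 ≤ m) (hn : m ≤ n) :
    ‖qInv m n * (-1) ^ j‖ = (q n n)⁻¹ := by
  rw [qInv, if_pos hn, norm_mul, norm_pow, norm_neg, norm_one, one_pow, mul_one,
    Complex.norm_real, Real.norm_eq_abs, abs_of_pos (inv_pos.2 (q_self_pos (hm.trans hn)))]

theorem degree_expo (i j k : ℕ) : (expo i j k).degree = i + j + k := by
  rw [Finsupp.degree_eq_sum, Fin.sum_univ_three]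
  simp

/-- The monomials `x^2 y^{n-2}` here, and `y^{n-1}` and `x y^{n-2}` for the other two cofactors,
carry the coefficients `±1/q_{n,n}`. -/
theorem divergent_cofA {m : ℕ} (hm : 1 ≤ m) :
    ¬ IsConvergent (glue fun n => qInv m n • cofA n) := by
  refine not_isConvergent_of_coeff (m + 2) fun n hn => ?_
  obtain ⟨k, rfl⟩ := Nat.exists_eq_add_of_le' ((Nat.le_add_left 2 m).trans hn)
  refine ⟨expo 2 k 0, by rw [degree_expo]; omega, ?_⟩
  rw [coeff_glue, expo_zero, expo_one, add_comm 2 k, map_smul, smul_eq_mul, coeff_cofA,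
    norm_qInv_mul hm (by omega)]

theorem divergent_cofB {m : ℕ} (hm : 1 ≤ m) :
    ¬ IsConvergent (glue fun n => qInv m (n + 1) • cofB (n + 1)) := by
  refine not_isConvergent_of_coeff (m + 1) fun n hn => ?_
  obtain ⟨k, rfl⟩ := Nat.exists_eq_add_of_le' ((Nat.le_add_left 1 m).trans hn)
  refine ⟨expo 0 k 0, by rw [degree_expo]; omega, ?_⟩
  rw [coeff_glue, expo_zero, expo_one, zero_add, map_smul, smul_eq_mul, coeff_cofB,
    norm_qInv_mul hm (by omega)]

theorem divergent_cofC {m : ℕ} (hm : 1 ≤ m) :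
    ¬ IsConvergent (glue fun n => qInv m (n + 1) • cofC (n + 1)) := by
  refine not_isConvergent_of_coeff (m + 2) fun n hn => ?_
  obtain ⟨k, rfl⟩ := Nat.exists_eq_add_of_le' ((Nat.le_add_left 2 m).trans hn)
  refine ⟨expo 1 k 0, by rw [degree_expo]; omega, ?_⟩
  rw [coeff_glue, expo_zero, expo_one, add_comm 1 k, map_smul, smul_eq_mul,
    show k + 1 + 1 = k + 2 from rfl, coeff_cofC, norm_qInv_mul hm (by omega)]

theorem representation_unique {a b c a' b' c' : Ser 3} (ha : a ∈ formalScope 3 2)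
    (hb : b ∈ formalScope 3 2) (ha' : a' ∈ formalScope 3 2) (hb' : b' ∈ formalScope 3 2)
    (he : a * f + b * g + c * h = a' * f + b' * g + c' * h) : a' = a ∧ b' = b ∧ c' = c := by
  have h1 := relation_trivial (c := c' - c) (sub_mem ha' ha) (sub_mem hb' hb)
    (by linear_combination -he)
  exact ⟨sub_eq_zero.1 h1.1, sub_eq_zero.1 h1.2.1, sub_eq_zero.1 h1.2.2⟩

end Gabrielov

open Echelon Gabrielov Filter Topology in
theorem mainTheorem3 :
    -- the sums defining `I` and its completion are direct, and `f, g, h` have no nontrivial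
    -- linear relation respecting the scopes
    iSupIndep (fun i => summand (convScope 3 (scopes i)) (gens i)) ∧
    iSupIndep (fun i => summand (formalScope 3 (scopes i)) (gens i)) ∧
    (∀ a : Fin 3 → Ser 3, (∀ i, a i ∈ formalScope 3 (scopes i)) →
      ∑ i, a i * gens i = 0 → a = 0) ∧
    -- the series `g_k`: `g_1 = g`, and `g_{k+1}` is the remainder of the division of
    -- `S(g_k, h)` by `f, g, h, g_2, …, g_k`
    gk 1 = g ∧
    (∀ k, 1 ≤ k → ∀ P, IsPartition (divisors k) (divisorScopes k) P → ∀ b,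
      (IsRemainder (divisors k) (divisorScopes k) P (sSeries (gk k) h) b ↔ b = gk (k + 1))) ∧
    -- together with `f` and `h` they form a standard basis, of `I` and of its completion
    IsStandardBasis (convScope 3) I basis basisScopes ∧
    IsStandardBasis (formalScope 3) Ihat basis basisScopes ∧
    -- the initial term of `g_k` is `q_{k,k} x^k z^k`
    (∀ k, 1 ≤ k → gk k ≠ 0 ∧
      initExp (gk k) = Finsupp.single 0 k + Finsupp.single 2 k ∧
      MvPowerSeries.coeff (initExp (gk k)) (gk k) = ((q k k : ℝ) : ℂ)) ∧
    -- size of the coefficients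
    (∀ k, 1 ≤ k → 0 < q k k ∧
      q (k + 1) (k + 1) / q k k = 1 / (4 * (2 * (k : ℝ) + 1) * (2 * (k : ℝ) - 1)) ∧
      ∀ i, k ≤ i → 0 < q i k ∧ q i k / q k k ≤ 1) ∧
    (∀ ρ : ℝ, Tendsto (fun k : ℕ => ρ ^ k * q k k) atTop (𝓝 0)) ∧
    -- the series `e = ∑_{k ≥ m} g_k / q_{k,k}`
    (∀ m, 1 ≤ m → ∃ e : Ser 3,
      IsFormalSum (fun j => (((q (m + j) (m + j))⁻¹ : ℝ) : ℂ) • gk (m + j)) e ∧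
      (∀ d, MvPowerSeries.coeff d e ≠ 0 → d 1 = 0) ∧
      e ∈ Ihat ⊓ convergentSeries 3 ∧
      e ∉ I ∧
      ∃ a ∈ formalScope 3 2, ∃ b ∈ formalScope 3 2, ∃ c ∈ formalScope 3 3,
        e = a * f + b * g + c * h ∧
        (∀ a' ∈ formalScope 3 2, ∀ b' ∈ formalScope 3 2, ∀ c' ∈ formalScope 3 3,
          e = a' * f + b' * g + c' * h → a' = a ∧ b' = b ∧ c' = c) ∧
        ¬ IsConvergent a ∧ ¬ IsConvergent b ∧ ¬ IsConvergent c) := by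
  refine ⟨iSupIndep_conv, iSupIndep_formal, ?_, gk_one, fun k hk P hP b => isRemainder_iff hk hP b,
    isStandardBasis_conv, isStandardBasis_formal, ?_, ?_, tendsto_pow_mul_q, ?_⟩
  · intro a ha h0
    rw [Fin.sum_univ_three] at h0
    obtain ⟨e0, e1, e2⟩ := relation_trivial (ha 0) (ha 1) h0
    funext i
    fin_cases i
    · exact e0
    · exact e1
    · exact e2
  · intro k hk
    have h1 : expo k 0 k = Finsupp.single 0 k + Finsupp.single 2 k := by simp [expo]
    refine ⟨gk_ne_zero hk, (initExp_gk hk).trans h1, ?_⟩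
    rw [initExp_gk hk, coeff_gk, if_pos (by simp), expo_two]
  · intro k hk
    refine ⟨q_self_pos hk, q_self_succ hk, fun i hi => ⟨q_pos hk hi, ?_⟩⟩
    rw [div_le_one (q_self_pos hk)]
    exact q_le hk hi
  · intro m hm
    have ha : (glue fun n => qInv m n • cofA n) ∈ formalScope 3 2 :=
      glue_mem_formalScope fun n => Submodule.smul_mem _ _ (cofA_mem n).1
    have hb : (glue fun n => qInv m (n + 1) • cofB (n + 1)) ∈ formalScope 3 2 :=
      glue_mem_formalScope fun n => Submodule.smul_mem _ _ (cofB_mem (n + 1)).1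
    refine ⟨gkSum m, isFormalSum_gkSum m, fun d => gkSum_scope,
      ⟨mem_echelon_gens.2 ⟨_, ha, _, hb, _, mem_formalScope_self _, gkSum_eq hm⟩,
        isConvergent_gkSum hm⟩, fun hI => ?_, _, ha, _, hb, _, mem_formalScope_self _, gkSum_eq hm,
      fun a' ha' b' hb' c' _ he => representation_unique ha hb ha' hb' ((gkSum_eq hm).symm.trans he),
      divergent_cofA hm, divergent_cofB hm, divergent_cofC hm⟩
    -- Membership in `I` would provide a convergent coefficient of `f`, which uniqueness identifies
    -- with the divergent one.
    obtain ⟨a', ha', b', hb', c', -, he⟩ := mem_echelon_gens.1 hI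
    have h1 := representation_unique ha hb ha'.1 hb'.1 ((gkSum_eq hm).symm.trans he)
    exact divergent_cofA hm (h1.1 ▸ ha'.2)
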